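/- Let $A$ be an integer $d\times n$ matrix with columns $A_1,\dots,A_n$, and suppose that $A$ is homogeneous: there is a nonzero $w\in\mathbb{R}^d$ with $w^TA_i=1$ for all $i$. For $b\in\mathbb{Z}^d$ and $1\le i\le n$ let $IP^+_i(A,b)$ be the maximum of $x_i$ over all $x\in\mathbb{Z}^n$ with $Ax=b$, $x\ge 0$, and let $LP^+_i(A,b)$ be the maximum of $x_i$ over all $x\in\mathbb{R}^n$ with $Ax=b$, $x\ge 0$. Call $b$ IP-feasible if $b=Ax$ for some $x\in\mathbb{Z}^n$ with $x\ge 0$. Let $P_A=\mathrm{conv}(A_1,\dots,A_n)$ and let $\mathcal{L}=\mathbb{Z}A_1+\dots+\mathbb{Z}A_n$ be the smallest lattice containing the columns. For a polytope $P$ with vertices in $\mathcal{L}$ and an ordering $p_1,\dots,p_k$ of the points of $P\cap\mathcal{L}$, the pulling triangulation $\Delta_{pull}(P)$ is defined recursively: if $p_1,\dots,p_k$ are affinely independent, then $\Delta_{pull}(P)=\{\{p_1,\dots,p_k\}\}$; otherwise $\Delta_{pull}(P)=\bigcup_F\{\{p_1\}\cup\sigma : \sigma\in\Delta_{pull}(F)\}$,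 the union being over all facets $F$ of $P$ not containing $p_1$, where the points of $F\cap\mathcal{L}$ carry the induced order. The polytope $P_A$ is called compressed if, for every ordering of $P_A\cap\mathcal{L}$, every simplex of the pulling triangulation of $P_A$ has the minimal volume among all simplices of dimension $\dim P_A$ with vertices in $P_A\cap\mathcal{L}$. Then $LP^+_i(A,b)=IP^+_i(A,b)$ for all $i=1,\dots,n$ and all IP-feasible $b$ if and only if $P_A$ is compressed. -/

import Mathlib

/-- The ambient space `ℝ^d`. Euclidean lengths enter only through the dot product. -/
abbrev Space (d : ℕ) : Type := Fin d → ℝ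

/-- The dimension of a nonempty convex set: the dimension of its affine hull. -/
noncomputable def convDim {d : ℕ} (P : Set (Space d)) : ℕ :=
  Module.finrank ℝ (vectorSpan ℝ P)

/-- A facet of a polytope `P`: a nonempty face (the set where some linear functional attains its
maximum over `P`) whose dimension is one less than that of `P`. -/
def IsFacet {d : ℕ} (P F : Set (Space d)) : Prop :=
  IsExposed ℝ P F ∧ F.Nonempty ∧ convDim F + 1 = convDim P

open Classical in
/-- `IsPullingSimplex P l σ`: the set `σ` is (the vertex set of) one of the simplices of the pulling
triangulation of the polytope `P` induced by the ordered list `l` of the lattice points of `P`.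
If the points of `l` are affinely independent, the only simplex is the set of all of them.
Otherwise the simplices are the `{p} ∪ σ`, where `p` is the first point of the list and `σ` is a
simplex of the pulling triangulation of a facet `F` of `P` with `p ∉ F`, the lattice points of `F`
being listed in the induced order. -/
inductive IsPullingSimplex {d : ℕ} :
    Set (Space d) → List (Space d) → Set (Space d) → Prop
  | simplex (P : Set (Space d)) (p : Space d) (l : List (Space d))
      (hind : AffineIndependent ℝ (fun i => (p :: l).get i)) :
      IsPullingSimplex P (p :: l) {x | x ∈ p :: l}
  | pull (P : Set (Space d)) (p : Space d) (l : List (Space d))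
      (hdep : ¬ AffineIndependent ℝ (fun i => (p :: l).get i))
      (F : Set (Space d)) (hF : IsFacet P F) (hp : p ∉ F) (σ : Set (Space d))
      (hσ : IsPullingSimplex F ((p :: l).filter (fun x => x ∈ F)) σ) :
      IsPullingSimplex P (p :: l) (insert p σ)

/-- The pulling triangulation of `P` induced by the list `l` of its lattice points, as the set of
the vertex sets of its maximal simplices. -/
def pullingTriangulation {d : ℕ} (P : Set (Space d)) (l : List (Space d)) : Set (Set (Space d)) :=
  {σ | IsPullingSimplex P l σ}

/-- The `k`-dimensional Euclidean volume of a `k`-simplex in `ℝ^d`: the square root of the Gram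
determinant of its edge vectors at one vertex, divided by `k!`. -/
noncomputable def simplexVolume {d k : ℕ} (s : Affine.Simplex ℝ (Space d) k) : ℝ :=
  Real.sqrt (Matrix.det (Matrix.of fun i j : Fin k =>
    (s.points i.succ - s.points 0) ⬝ᵥ (s.points j.succ - s.points 0))) / (k.factorial : ℝ)

/-- A triangulation `T` of `P` is unimodular with respect to the lattice `L` if each of its
simplices is a simplex of the dimension of `P` whose volume is minimal among all the simplices of
that dimension whose vertices are points of `L` in `P`. -/
def IsUnimodularTriangulation {d : ℕ} (L : Submodule ℤ (Space d)) (P : Set (Space d))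
    (T : Set (Set (Space d))) : Prop :=
  ∀ σ ∈ T, ∃ s : Affine.Simplex ℝ (Space d) (convDim P), Set.range s.points = σ ∧
    ∀ t : Affine.Simplex ℝ (Space d) (convDim P),
      Set.range t.points ⊆ (L : Set (Space d)) ∩ P → simplexVolume s ≤ simplexVolume t

/-- `P` is compressed with respect to the lattice `L`: for every ordering of the points of `L` in
`P`, the pulling triangulation is unimodular. -/
def IsCompressed {d : ℕ} (L : Submodule ℤ (Space d)) (P : Set (Space d)) : Prop :=
  ∀ l : List (Space d), l.Nodup → (∀ x, x ∈ l ↔ x ∈ (L : Set (Space d)) ∩ P) →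
    IsUnimodularTriangulation L P (pullingTriangulation P l)

/-- The `i`-th column of an integer matrix, as a point of `ℝ^d`. -/
def colPoint {d n : ℕ} (A : Matrix (Fin d) (Fin n) ℤ) (i : Fin n) : Space d :=
  fun j => (A j i : ℝ)

/-- The polytope `P_A`, the convex hull of the columns of `A`. -/
def colPolytope {d n : ℕ} (A : Matrix (Fin d) (Fin n) ℤ) : Set (Space d) :=
  convexHull ℝ (Set.range (colPoint A))

/-- The smallest lattice containing the columns of `A`. -/
def colLattice {d n : ℕ} (A : Matrix (Fin d) (Fin n) ℤ) : Submodule ℤ (Space d) :=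
  Submodule.span ℤ (Set.range (colPoint A))

/-- `A` is homogeneous: some nonzero weight vector has product `1` with every column. -/
def IsHomogeneousMatrix {d n : ℕ} (A : Matrix (Fin d) (Fin n) ℤ) : Prop :=
  ∃ w : Space d, w ≠ 0 ∧ ∀ i, w ⬝ᵥ colPoint A i = 1

/-- The feasible points of the integer program `A x = b`, `x ≥ 0`, `x` integral. -/
def ipFeasible {d n : ℕ} (A : Matrix (Fin d) (Fin n) ℤ) (b : Fin d → ℤ) : Set (Fin n → ℤ) :=
  {x | A.mulVec x = b ∧ 0 ≤ x}

/-- The feasible points of the linear relaxation `A x = b`, `x ≥ 0`. -/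
def lpFeasible {d n : ℕ} (A : Matrix (Fin d) (Fin n) ℤ) (b : Fin d → ℤ) : Set (Fin n → ℝ) :=
  {x | (A.map (fun a : ℤ => (a : ℝ))).mulVec x = (fun j => (b j : ℝ)) ∧ 0 ≤ x}

/-- The optimal value of the integer program "maximize `x i`", as an extended real. -/
noncomputable def ipMax {d n : ℕ} (A : Matrix (Fin d) (Fin n) ℤ) (b : Fin d → ℤ) (i : Fin n) :
    EReal :=
  ⨆ x ∈ ipFeasible A b, (((x i : ℤ) : ℝ) : EReal)

/-- The optimal value of the linear program "maximize `x i`", as an extended real. -/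
noncomputable def lpMax {d n : ℕ} (A : Matrix (Fin d) (Fin n) ℤ) (b : Fin d → ℤ) (i : Fin n) :
    EReal :=
  ⨆ x ∈ lpFeasible A b, ((x i : ℝ) : EReal)

/-! Homogeneity puts the set `S` of columns in the hyperplane `w = 1`, so `P_A` is a cross-section
of the cone over `S`: facets become zero sets of nonnegative functionals, and pulling simplices
become linearly independent sets whose cones cover the cone. Equality of the two programs becomes
`RoundsUp S` (`roundsUp_range_colPoint_iff`).

If `S` rounds up, the semigroup it generates is normal (`RoundsUp.mem_closure`), so every lattice
point of `P_A` is a column. Let a semigroup element `b` lie in the cone of a pulling simplex with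
first vertex `p`. Its coefficient at `p` is the largest possible, since the rest lies on a facet
missing `p`; rounding up forces it to be an integer, and one recurses on the facet
(`RoundsUp.mem_closure_simplex`). Hence the simplex generates the lattice, and its volume is
minimal.

Conversely, pulling first at a lattice point `p` off a facet, and exchanging `p` for another such
point `q`, minimality of volume shows that all lattice points off the facet are equally far from it
(`IsCompressed.isTwoLevel`). The normalised facet functionals are then integral on the lattice and
read off coordinates in any pulling simplex (`IsTwoLevel.mem_span_int`). Given `b = a • p + c`, pull
first at `p`: some simplex `σ` contains `p` and has `c` in its cone, and the integral coordinates of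
`b` in `σ` are the required rounding (`IsCompressed.roundsUp`). -/

open Module

/-! ### Facets of a polytope as facets of the cone over it -/

/-- The points of `T` at which the functional `f` vanishes. -/
def zeroSet {d : ℕ} (T : Set (Space d)) (f : Dual ℝ (Space d)) : Set (Space d) :=
  {t ∈ T | f t = 0}

/-- A functional that is nonnegative on `T` and vanishes on a subset of `T` of corank one. -/
def IsFacetFunctional {d : ℕ} (T : Set (Space d)) (f : Dual ℝ (Space d)) : Prop :=
  (∀ t ∈ T, 0 ≤ f t) ∧
    finrank ℝ (Submodule.span ℝ (zeroSet T f)) + 1 = finrank ℝ (Submodule.span ℝ T)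

section Cones

variable {d : ℕ} {T : Set (Space d)} {w f : Dual ℝ (Space d)}

theorem zeroSet_subset : zeroSet T f ⊆ T := fun _ h => h.1

theorem nonneg_of_mem_hull (hf : ∀ t ∈ T, 0 ≤ f t) {x : Space d}
    (hx : x ∈ PointedCone.hull ℝ T) : 0 ≤ f x := by
  induction hx using Submodule.span_induction with
  | mem x h => exact hf x h
  | zero => simp
  | add x y _ _ hx hy => rw [map_add]; exact add_nonneg hx hy
  | smul a x _ hx =>
    have : f (a • x) = (a : ℝ) * f x := by
      rw [← smul_eq_mul, ← map_smul]; rfl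
    rw [this]; exact mul_nonneg a.2 hx

theorem smul_mem_hull {x : Space d} (hx : x ∈ PointedCone.hull ℝ T) {c : ℝ} (hc : 0 ≤ c) :
    c • x ∈ PointedCone.hull ℝ T :=
  Submodule.smul_mem _ (⟨c, hc⟩ : {c : ℝ // 0 ≤ c}) hx

/-- A vanishing sum of nonnegative terms has only vanishing terms. -/
theorem mem_hull_zeroSet (hf : ∀ t ∈ T, 0 ≤ f t) {x : Space d}
    (hx : x ∈ PointedCone.hull ℝ T) (h0 : f x = 0) : x ∈ PointedCone.hull ℝ (zeroSet T f) := by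
  induction hx using Submodule.span_induction with
  | mem x h => exact Submodule.subset_span ⟨h, h0⟩
  | zero => exact zero_mem _
  | add x y hx hy ihx ihy =>
    have h1 := nonneg_of_mem_hull hf hx
    have h2 := nonneg_of_mem_hull hf hy
    rw [map_add] at h0
    exact add_mem (ihx (by linarith)) (ihy (by linarith))
  | smul a x hx ih =>
    have : f (a • x) = (a : ℝ) * f x := by
      rw [← smul_eq_mul, ← map_smul]; rfl
    rw [this] at h0
    rcases mul_eq_zero.1 h0 with h | h
    · have : a = 0 := Subtype.ext h
      rw [this, zero_smul]; exact zero_mem _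
    · exact Submodule.smul_mem _ _ (ih h)

theorem vanish_on_hull {x : Space d} (hx : x ∈ PointedCone.hull ℝ (zeroSet T f)) : f x = 0 := by
  have h1 := nonneg_of_mem_hull (f := f) (fun t ht => ht.2.ge) hx
  have h2 := nonneg_of_mem_hull (f := -f) (fun t ht => by simp [ht.2]) hx
  simp at h2
  linarith

theorem convexHull_subset_hull : convexHull ℝ T ⊆ PointedCone.hull ℝ T := by
  refine convexHull_min Submodule.subset_span ?_
  intro x hx y hy a b ha hb _
  exact add_mem (smul_mem_hull hx ha) (smul_mem_hull hy hb)

theorem hull_le_of_subset_convexHull {U : Set (Space d)} (h : U ⊆ convexHull ℝ T) :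
    PointedCone.hull ℝ U ≤ PointedCone.hull ℝ T :=
  Submodule.span_le.2 (h.trans convexHull_subset_hull)

theorem eq_one_of_mem_convexHull (hw : ∀ t ∈ T, w t = 1) {x : Space d}
    (hx : x ∈ convexHull ℝ T) : w x = 1 := by
  have : convexHull ℝ T ⊆ {y | w y = 1} :=
    convexHull_min hw (convex_hyperplane w.isLinear 1)
  exact this hx

/-- The alternative `x = 0` is needed only for empty `T`. -/
theorem eq_smul_of_mem_hull (hw : ∀ t ∈ T, w t = 1) {x : Space d}
    (hx : x ∈ PointedCone.hull ℝ T) : x = 0 ∨ ∃ y ∈ convexHull ℝ T, x = w x • y := by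
  induction hx using Submodule.span_induction with
  | mem x h => exact Or.inr ⟨x, subset_convexHull ℝ _ h, by simp [hw x h]⟩
  | zero => exact Or.inl rfl
  | add x y hx hy ihx ihy =>
    have h1 := nonneg_of_mem_hull (f := w) (fun t ht => by simp [hw t ht]) hx
    have h2 := nonneg_of_mem_hull (f := w) (fun t ht => by simp [hw t ht]) hy
    rcases ihx with rfl | ⟨x', hx', ex⟩
    · simpa using ihy
    rcases ihy with rfl | ⟨y', hy', ey⟩
    · right; exact ⟨x', hx', by simpa using ex⟩
    rcases h1.eq_or_lt with h | h
    · rw [← h, zero_smul] at ex; subst ex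
      right; exact ⟨y', hy', by simpa using ey⟩
    right
    have hs : w x + w y ≠ 0 := by linarith
    refine ⟨(w x / (w x + w y)) • x' + (w y / (w x + w y)) • y',
      convex_convexHull ℝ T hx' hy' (by positivity) (by positivity) (by field_simp), ?_⟩
    rw [map_add, smul_add, smul_smul, smul_smul, mul_div_cancel₀ _ hs, mul_div_cancel₀ _ hs,
      ← ex, ← ey]
  | smul a x hx ih =>
    have : w (a • x) = (a : ℝ) * w x := by
      rw [← smul_eq_mul, ← map_smul]; rfl
    rcases ih with rfl | ⟨y, hy, e⟩
    · left; simp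
    · right
      refine ⟨y, hy, ?_⟩
      rw [this, mul_smul, ← e]; rfl

theorem mem_convexHull_of_mem_hull (hw : ∀ t ∈ T, w t = 1) {x : Space d}
    (hx : x ∈ PointedCone.hull ℝ T) (h1 : w x = 1) : x ∈ convexHull ℝ T := by
  rcases eq_smul_of_mem_hull hw hx with rfl | ⟨y, hy, e⟩
  · simp at h1
  · rw [h1, one_smul] at e; rwa [e]

theorem mem_convexHull_zeroSet_iff (hw : ∀ t ∈ T, w t = 1) (hf : ∀ t ∈ T, 0 ≤ f t)
    {x : Space d} : x ∈ convexHull ℝ (zeroSet T f) ↔ x ∈ convexHull ℝ T ∧ f x = 0 := by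
  constructor
  · intro h
    exact ⟨convexHull_mono zeroSet_subset h, vanish_on_hull (convexHull_subset_hull h)⟩
  · rintro ⟨h, h0⟩
    exact mem_convexHull_of_mem_hull (w := w) (fun t ht => hw t ht.1)
      (mem_hull_zeroSet hf (convexHull_subset_hull h) h0) (eq_one_of_mem_convexHull hw h)

theorem hull_subset_span {x : Space d} (hx : x ∈ PointedCone.hull ℝ T) :
    x ∈ Submodule.span ℝ T :=
  PointedCone.hull_le_span (R := ℝ) T hx

theorem convexHull_subset_span {x : Space d} (hx : x ∈ convexHull ℝ T) :
    x ∈ Submodule.span ℝ T := hull_subset_span (convexHull_subset_hull hx)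

/-- `w` kills all directions within `T` but not a point of `T`, so the span is the direct sum of the
direction space and one line. -/
theorem finrank_span_eq_convDim_add_one (hw : ∀ t ∈ T, w t = 1) (hT : T.Nonempty) :
    finrank ℝ (Submodule.span ℝ T) = convDim (convexHull ℝ T) + 1 := by
  obtain ⟨t₀, ht₀⟩ := hT
  have hv : vectorSpan ℝ (convexHull ℝ T) = vectorSpan ℝ T := by
    rw [← direction_affineSpan, affineSpan_convexHull, direction_affineSpan]
  have hker : vectorSpan ℝ T ≤ LinearMap.ker w := by
    rw [vectorSpan_def, Submodule.span_le]
    rintro _ ⟨a, ha, b, hb, rfl⟩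
    simp [hw a ha, hw b hb]
  have hsup : Submodule.span ℝ T = vectorSpan ℝ T ⊔ Submodule.span ℝ {t₀} := by
    apply le_antisymm
    · rw [Submodule.span_le]
      intro t ht
      have : t = (t - t₀) + t₀ := by abel
      rw [this]
      exact Submodule.add_mem_sup (vsub_mem_vectorSpan ℝ ht ht₀)
        (Submodule.mem_span_singleton_self t₀)
    · refine sup_le ?_ (Submodule.span_mono (by simpa using ht₀))
      rw [vectorSpan_def, Submodule.span_le]
      rintro _ ⟨a, ha, b, hb, rfl⟩
      exact sub_mem (Submodule.subset_span ha) (Submodule.subset_span hb)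
  have hinf : vectorSpan ℝ T ⊓ Submodule.span ℝ {t₀} = ⊥ := by
    rw [eq_bot_iff]
    rintro x ⟨h1, h2⟩
    obtain ⟨c, rfl⟩ := Submodule.mem_span_singleton.1 h2
    have := hker h1
    simp [hw t₀ ht₀] at this
    simp [this]
  have h0 : t₀ ≠ 0 := by
    rintro rfl
    have := hw 0 ht₀
    simp at this
  have := Submodule.finrank_sup_add_finrank_inf_eq (vectorSpan ℝ T) (Submodule.span ℝ {t₀})
  rw [hinf, ← hsup, finrank_bot, finrank_span_singleton h0] at this
  rw [convDim, hv]
  simpa using this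

theorem isFacet_convexHull_iff (hw : ∀ t ∈ T, w t = 1) {F : Set (Space d)} :
    IsFacet (convexHull ℝ T) F ↔ ∃ f : Dual ℝ (Space d), IsFacetFunctional T f ∧
      (zeroSet T f).Nonempty ∧ F = convexHull ℝ (zeroSet T f) := by
  constructor
  · rintro ⟨hexp, ⟨x₀, hx₀⟩, hdim⟩
    obtain ⟨l, rfl⟩ := hexp ⟨x₀, hx₀⟩
    -- On `w = 1` the multiple of `w` is the constant maximum of `l`, so `f` measures how far `l`
    -- falls short of it.
    set f : Dual ℝ (Space d) := (l x₀) • w - (l : Space d →ₗ[ℝ] ℝ)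
    have hfx : ∀ x ∈ convexHull ℝ T, f x = l x₀ - l x := fun x hx => by
      simp [f, eq_one_of_mem_convexHull hw hx]
    have hf : ∀ t ∈ T, 0 ≤ f t := fun t ht => by
      rw [hfx t (subset_convexHull ℝ _ ht)]
      have := hx₀.2 t (subset_convexHull ℝ _ ht)
      linarith
    have hF : {x ∈ convexHull ℝ T | ∀ y ∈ convexHull ℝ T, l y ≤ l x}
        = convexHull ℝ (zeroSet T f) := by
      ext x
      rw [mem_convexHull_zeroSet_iff hw hf]
      constructor
      · rintro ⟨h1, h2⟩
        refine ⟨h1, ?_⟩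
        rw [hfx x h1]
        have := hx₀.2 x h1
        have := h2 x₀ hx₀.1
        linarith
      · rintro ⟨h1, h2⟩
        rw [hfx x h1] at h2
        refine ⟨h1, fun y hy => ?_⟩
        have := hx₀.2 y hy
        linarith
    have hne : (zeroSet T f).Nonempty := by
      rw [← convexHull_nonempty_iff (𝕜 := ℝ), ← hF]; exact ⟨x₀, hx₀⟩
    refine ⟨f, ⟨hf, ?_⟩, hne, hF⟩
    rw [finrank_span_eq_convDim_add_one (w := w) (fun t ht => hw t ht.1) hne,
      finrank_span_eq_convDim_add_one hw (hne.mono zeroSet_subset), ← hF, hdim]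
  · rintro ⟨f, ⟨hf, hr⟩, hne, rfl⟩
    refine ⟨?_, hne.convexHull, ?_⟩
    · intro _
      obtain ⟨t₀, ht₀⟩ := hne
      refine ⟨-(LinearMap.toContinuousLinearMap f), ?_⟩
      ext x
      rw [mem_convexHull_zeroSet_iff hw hf]
      simp only [Set.mem_ofPred_eq, neg_apply,
        LinearMap.coe_toContinuousLinearMap', neg_le_neg_iff]
      refine and_congr_right fun hx => ⟨fun h y hy => ?_, fun h => ?_⟩
      · rw [h]; exact nonneg_of_mem_hull hf (convexHull_subset_hull hy)
      · have := h t₀ (subset_convexHull ℝ _ ht₀.1)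
        rw [ht₀.2] at this
        exact le_antisymm this (nonneg_of_mem_hull hf (convexHull_subset_hull hx))
    · rw [finrank_span_eq_convDim_add_one (w := w) (fun t ht => hw t ht.1) hne,
        finrank_span_eq_convDim_add_one hw (hne.mono zeroSet_subset)] at hr
      omega

theorem vanish_on_span {x : Space d} (hx : x ∈ Submodule.span ℝ (zeroSet T f)) : f x = 0 := by
  have : Submodule.span ℝ (zeroSet T f) ≤ LinearMap.ker f :=
    Submodule.span_le.2 fun t ht => ht.2
  exact this hx

theorem IsFacetFunctional.span_insert (hf : IsFacetFunctional T f) {p : Space d}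
    (hp : p ∈ Submodule.span ℝ T) (hfp : f p ≠ 0) :
    Submodule.span ℝ (insert p (zeroSet T f)) = Submodule.span ℝ T := by
  have hle : Submodule.span ℝ (insert p (zeroSet T f)) ≤ Submodule.span ℝ T := by
    rw [Submodule.span_le, Set.insert_subset_iff]
    exact ⟨hp, fun t ht => Submodule.subset_span ht.1⟩
  refine Submodule.eq_of_le_of_finrank_le hle ?_
  have hlt : Submodule.span ℝ (zeroSet T f) < Submodule.span ℝ (insert p (zeroSet T f)) := by
    refine lt_of_le_of_ne (Submodule.span_mono (Set.subset_insert _ _)) fun h => hfp ?_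
    exact vanish_on_span (h ▸ Submodule.subset_span (Set.mem_insert p _))
  have := Submodule.finrank_lt_finrank_of_lt hlt
  have := hf.2
  omega

/-- A functional nonnegative on `T` and nonzero at `y` can be rotated to a facet functional without
changing its value at `y`. -/
theorem exists_isFacetFunctional_eq (hT : T.Finite) {y : Space d} (hy : y ∈ Submodule.span ℝ T)
    (hf : ∀ t ∈ T, 0 ≤ f t) (hfy : f y ≠ 0) :
    ∃ g, IsFacetFunctional T g ∧ g y = f y := by
  induction hk : finrank ℝ (Submodule.span ℝ T) - finrank ℝ (Submodule.span ℝ (zeroSet T f))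
    using Nat.strong_induction_on generalizing f with
  | _ k ih =>
  have hlt : Submodule.span ℝ (zeroSet T f) < Submodule.span ℝ (insert y (zeroSet T f)) := by
    refine lt_of_le_of_ne (Submodule.span_mono (Set.subset_insert _ _)) fun h => hfy ?_
    exact vanish_on_span (h ▸ Submodule.subset_span (Set.mem_insert y _))
  have hle : Submodule.span ℝ (insert y (zeroSet T f)) ≤ Submodule.span ℝ T := by
    rw [Submodule.span_le, Set.insert_subset_iff]
    exact ⟨hy, fun t ht => Submodule.subset_span ht.1⟩
  rcases hle.eq_or_lt with heq | hlt'
  · refine ⟨f, ⟨hf, ?_⟩, rfl⟩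
    have h1 := Submodule.finrank_lt_finrank_of_lt hlt
    have h2 : finrank ℝ (Submodule.span ℝ (insert y (zeroSet T f))) ≤
        finrank ℝ (Submodule.span ℝ (zeroSet T f)) + 1 := by
      rw [Submodule.span_insert]
      have := Submodule.finrank_add_le_finrank_add_finrank (Submodule.span ℝ {y})
        (Submodule.span ℝ (zeroSet T f))
      have := finrank_span_le_card (R := ℝ) ({y} : Set (Space d))
      simp at this
      omega
    rw [heq] at h1 h2
    omega
  · have : ∃ s ∈ T, s ∉ Submodule.span ℝ (insert y (zeroSet T f)) := by
      by_contra! h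
      exact hlt'.not_ge (Submodule.span_le.2 h)
    obtain ⟨s, hs, hsn⟩ := this
    have : ∃ g : Dual ℝ (Space d), g s < 0 ∧
        Submodule.span ℝ (insert y (zeroSet T f)) ≤ LinearMap.ker g := by
      obtain ⟨g, h1, h2⟩ := Submodule.exists_le_ker_of_notMem hsn
      rcases lt_or_gt_of_ne h1 with h | h
      · exact ⟨g, h, h2⟩
      · refine ⟨-g, by simpa using h, fun x hx => ?_⟩
        have := h2 hx
        simp at this ⊢
        exact this
    obtain ⟨g, hgs, hg⟩ := this
    have hgy : g y = 0 := hg (Submodule.subset_span (Set.mem_insert y _))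
    have hgz : ∀ t ∈ zeroSet T f, g t = 0 := fun t ht =>
      hg (Submodule.subset_span (Set.mem_insert_of_mem y ht))
    -- Rotate from `f` towards `g`, which vanishes at `y` and on the current zero set. The least
    -- ratio is the largest `c` keeping `f + c • g` nonnegative, and `s₀` becomes a new zero.
    obtain ⟨s₀, ⟨hs₀, hgs₀⟩, hmin⟩ := Set.exists_min_image {t ∈ T | g t < 0}
      (fun t => f t / -g t) (hT.subset fun t ht => ht.1) ⟨s, hs, hgs⟩
    set c := f s₀ / -g s₀ with hc
    have hc0 : 0 ≤ c := div_nonneg (hf s₀ hs₀) (by linarith)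
    have hf' : ∀ t ∈ T, 0 ≤ (f + c • g) t := by
      intro t ht
      simp only [LinearMap.add_apply, LinearMap.smul_apply, smul_eq_mul]
      rcases lt_or_ge (g t) 0 with h | h
      · have := hmin t ⟨ht, h⟩
        rw [le_div_iff₀ (by linarith)] at this
        linarith
      · have := hf t ht
        positivity
    have hfy' : (f + c • g) y = f y := by simp [hgy]
    have hz : zeroSet T f ⊆ zeroSet T (f + c • g) := fun t ht =>
      ⟨ht.1, by simp [ht.2, hgz t ht]⟩
    have hs₀z : s₀ ∈ zeroSet T (f + c • g) := by
      refine ⟨hs₀, ?_⟩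
      simp only [LinearMap.add_apply, LinearMap.smul_apply, smul_eq_mul, hc]
      have : g s₀ ≠ 0 := hgs₀.ne
      field_simp
      ring
    have hlt2 : Submodule.span ℝ (zeroSet T f) < Submodule.span ℝ (zeroSet T (f + c • g)) := by
      refine lt_of_le_of_ne (Submodule.span_mono hz) fun h => hgs₀.ne ?_
      have : s₀ ∈ Submodule.span ℝ (zeroSet T f) := h ▸ Submodule.subset_span hs₀z
      exact hg (Submodule.span_mono (Set.subset_insert _ _) this)
    have h1 := Submodule.finrank_lt_finrank_of_lt hlt2
    have h2 := Submodule.finrank_lt_finrank_of_lt hlt'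
    have h3 := Submodule.finrank_lt_finrank_of_lt hlt
    obtain ⟨g', hg', e⟩ := ih _ (by omega) hf' (by rwa [hfy']) rfl
    exact ⟨g', hg', e.trans hfy'⟩

theorem exists_nonneg_of_notMem_hull (hT : T.Finite) (hw : ∀ t ∈ T, w t = 1) {y : Space d}
    (hy : y ∉ PointedCone.hull ℝ T) : ∃ f : Dual ℝ (Space d), (∀ t ∈ T, 0 ≤ f t) ∧ f y < 0 := by
  rcases lt_trichotomy (w y) 0 with h | h | h
  · exact ⟨w, fun t ht => by simp [hw t ht], h⟩
  -- Here `y` is parallel to the hyperplane: any `g` positive at `y` works, once a large multiple of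
  -- `w` restores the sign on `T`.
  · have hy0 : y ∉ (⊥ : Submodule ℝ (Space d)) := by
      rw [Submodule.mem_bot]; rintro rfl; exact hy (zero_mem _)
    obtain ⟨g, hg, -⟩ := Submodule.exists_le_ker_of_notMem hy0
    have : ∃ g : Dual ℝ (Space d), 0 < g y := by
      rcases lt_or_gt_of_ne hg with h | h
      · exact ⟨-g, by simpa using h⟩
      · exact ⟨g, h⟩
    obtain ⟨g, hg⟩ := this
    obtain ⟨M, hM⟩ := (hT.image g).bddAbove
    refine ⟨M • w - g, fun t ht => ?_, by simp [h, hg]⟩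
    have := hM ⟨t, ht, rfl⟩
    simp [hw t ht, this]
  · have hn : (w y)⁻¹ • y ∉ convexHull ℝ T := fun hc => hy <| by
      have := smul_mem_hull (convexHull_subset_hull hc) h.le
      rwa [smul_smul, mul_inv_cancel₀ h.ne', one_smul] at this
    obtain ⟨g, u, h1, h2⟩ := geometric_hahn_banach_point_closed (convex_convexHull ℝ T)
      (hT.isCompact_convexHull ℝ).isClosed hn
    -- Multiplying the threshold `u` by `w` makes the affine separation linear.
    refine ⟨(g : Space d →ₗ[ℝ] ℝ) - u • w, fun t ht => ?_, ?_⟩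
    · have := h2 t (subset_convexHull ℝ _ ht)
      simp [hw t ht, this.le]
    · rw [map_smul, smul_eq_mul, inv_mul_lt_iff₀ h] at h1
      simp only [LinearMap.sub_apply, ContinuousLinearMap.coe_coe, LinearMap.smul_apply,
        smul_eq_mul]
      linarith

theorem exists_isFacetFunctional_of_notMem_hull (hT : T.Finite) (hw : ∀ t ∈ T, w t = 1)
    {y : Space d} (hs : y ∈ Submodule.span ℝ T) (hy : y ∉ PointedCone.hull ℝ T) :
    ∃ f, IsFacetFunctional T f ∧ f y < 0 := by
  obtain ⟨f, hf, hfy⟩ := exists_nonneg_of_notMem_hull hT hw hy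
  obtain ⟨g, hg, e⟩ := exists_isFacetFunctional_eq hT hs hf hfy.ne
  exact ⟨g, hg, e ▸ hfy⟩

/-- The two functionals are proportional on the span of `T`. Hence finitely many zero sets give
finitely many ratios, and a minimum exists in `exists_exit_facet`. -/
theorem IsFacetFunctional.div_eq_div {g : Dual ℝ (Space d)} (hf : IsFacetFunctional T f)
    (hz : zeroSet T f = zeroSet T g) {p b : Space d} (hp : p ∈ Submodule.span ℝ T)
    (hb : b ∈ Submodule.span ℝ T) (hfp : f p ≠ 0) (hgp : g p ≠ 0) :
    f b / f p = g b / g p := by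
  rw [← hf.span_insert hp hfp] at hb
  have : Submodule.span ℝ (insert p (zeroSet T f)) ≤ LinearMap.ker (g p • f - f p • g) := by
    rw [Submodule.span_le, Set.insert_subset_iff]
    refine ⟨by simp [mul_comm], fun t ht => ?_⟩
    have h1 := ht.2
    have h2 := (hz ▸ ht : t ∈ zeroSet T g).2
    simp [h1, h2]
  have := this hb
  simp at this
  rw [div_eq_div_iff hfp hgp]
  linarith

/-- Moving from a point `b` of the cone in the direction `-p` one leaves the cone through a facet
that does not contain `p`. -/
theorem exists_exit_facet (hT : T.Finite) (hw : ∀ t ∈ T, w t = 1) {p b : Space d}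
    (hp : p ∈ convexHull ℝ T) (hb : b ∈ PointedCone.hull ℝ T) :
    ∃ f, IsFacetFunctional T f ∧ 0 < f p ∧ ∃ c : ℝ, 0 ≤ c ∧
      b - c • p ∈ PointedCone.hull ℝ (zeroSet T f) := by
  classical
  have hps := convexHull_subset_span hp
  have hbs := hull_subset_span hb
  let Φ : Set (Dual ℝ (Space d)) := {f | IsFacetFunctional T f ∧ 0 < f p}
  let Λ : Set ℝ := (fun f : Dual ℝ (Space d) => f b / f p) '' Φ
  have hfin : Λ.Finite := by
    have hZ : (zeroSet T '' Φ).Finite := by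
      refine hT.finite_subsets.subset ?_
      rintro _ ⟨f, -, rfl⟩
      exact zeroSet_subset
    choose! φ hφ using fun Z (hZ : Z ∈ zeroSet T '' Φ) => hZ
    refine (hZ.image fun Z => φ Z b / φ Z p).subset ?_
    rintro _ ⟨f, hf, rfl⟩
    refine ⟨zeroSet T f, ⟨f, hf, rfl⟩, ?_⟩
    obtain ⟨h1, h2⟩ := hφ _ ⟨f, hf, rfl⟩
    exact h1.1.div_eq_div h2 hps hbs h1.2.ne' hf.2.ne'
  have hne : Λ.Nonempty := by
    have hwp := eq_one_of_mem_convexHull hw hp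
    obtain ⟨f, hf, e⟩ := exists_isFacetFunctional_eq (f := w) hT hps
      (fun t ht => by simp [hw t ht]) (by simp [hwp])
    exact ⟨_, f, ⟨hf, by simp [e, hwp]⟩, rfl⟩
  -- `f b / f p` is the time at which `b - c • p` crosses the facet of `f`; the first crossing is
  -- the exit from the cone.
  obtain ⟨_, ⟨f, hf, rfl⟩, hmin⟩ := Set.exists_min_image Λ id hfin hne
  simp only [id] at hmin
  refine ⟨f, hf.1, hf.2, f b / f p, div_nonneg (nonneg_of_mem_hull hf.1.1 hb) hf.2.le, ?_⟩
  refine mem_hull_zeroSet hf.1.1 ?_ ?_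
  · by_contra hn
    obtain ⟨g, hg, hgn⟩ := exists_isFacetFunctional_of_notMem_hull hT hw
      (sub_mem hbs (Submodule.smul_mem _ _ hps)) hn
    rw [map_sub, map_smul, smul_eq_mul] at hgn
    have hgb := nonneg_of_mem_hull hg.1 hb
    rcases (nonneg_of_mem_hull hg.1 (convexHull_subset_hull hp)).eq_or_lt with h | h
    · rw [← h] at hgn; linarith
    · have := hmin _ ⟨g, ⟨hg, h⟩, rfl⟩
      rw [le_div_iff₀ h] at this
      linarith
  · have := hf.2.ne'
    simp [map_sub]
    field_simp
    ring

/-- Every facet of a facet is cut out by another facet. -/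
theorem IsFacetFunctional.exists_extend {g : Dual ℝ (Space d)} (hT : T.Finite)
    (hf : IsFacetFunctional T f) (hg : IsFacetFunctional (zeroSet T f) g) :
    ∃ h, IsFacetFunctional T h ∧ ∀ t ∈ Submodule.span ℝ (zeroSet T f), h t = g t := by
  have hne : {t ∈ T | f t ≠ 0}.Nonempty := by
    by_contra hemp
    have : zeroSet T f = T := by
      refine zeroSet_subset.antisymm fun t ht => ⟨ht, ?_⟩
      by_contra h
      exact hemp ⟨t, ht, h⟩
    have h2 := hf.2
    rw [this] at h2
    omega
  -- The largest ratio is the least `c` making `g + c • f` nonnegative off the facet; `s` is a zero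
  -- gained there.
  obtain ⟨s, ⟨hs, hfs⟩, hmax⟩ := Set.exists_max_image {t ∈ T | f t ≠ 0}
    (fun t => -g t / f t) (hT.subset fun t ht => ht.1) hne
  set c := -g s / f s with hc
  have hag : ∀ t ∈ Submodule.span ℝ (zeroSet T f), (g + c • f) t = g t := fun t ht => by
    simp [vanish_on_span ht]
  have hnn : ∀ t ∈ T, 0 ≤ (g + c • f) t := by
    intro t ht
    by_cases h : f t = 0
    · rw [hag t (Submodule.subset_span ⟨ht, h⟩)]
      exact hg.1 t ⟨ht, h⟩
    · have h0 : 0 < f t := lt_of_le_of_ne (hf.1 t ht) (Ne.symm h)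
      have := hmax t ⟨ht, h⟩
      rw [div_le_iff₀ h0] at this
      simp only [LinearMap.add_apply, LinearMap.smul_apply, smul_eq_mul]
      linarith
  refine ⟨g + c • f, ⟨hnn, ?_⟩, hag⟩
  have hz : zeroSet (zeroSet T f) g ⊆ zeroSet T (g + c • f) := fun t ht =>
    ⟨ht.1.1, by rw [hag t (Submodule.subset_span ht.1)]; exact ht.2⟩
  have hsz : s ∈ zeroSet T (g + c • f) := by
    refine ⟨hs, ?_⟩
    simp only [LinearMap.add_apply, LinearMap.smul_apply, smul_eq_mul, hc]
    field_simp
    ring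
  -- The new zero span lies strictly between corank two and corank zero.
  have hlt1 : Submodule.span ℝ (zeroSet (zeroSet T f) g) <
      Submodule.span ℝ (zeroSet T (g + c • f)) := by
    refine lt_of_le_of_ne (Submodule.span_mono hz) fun h => hfs ?_
    have : s ∈ Submodule.span ℝ (zeroSet (zeroSet T f) g) := h ▸ Submodule.subset_span hsz
    exact vanish_on_span (Submodule.span_mono zeroSet_subset this)
  have hlt2 : Submodule.span ℝ (zeroSet T (g + c • f)) < Submodule.span ℝ T := by
    refine lt_of_le_of_ne (Submodule.span_mono zeroSet_subset) fun h => ?_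
    have hg0 : zeroSet (zeroSet T f) g = zeroSet T f := by
      refine zeroSet_subset.antisymm fun t ht => ⟨ht, ?_⟩
      rw [← hag t (Submodule.subset_span ht)]
      exact vanish_on_span (h ▸ Submodule.subset_span ht.1)
    have h2 := hg.2
    rw [hg0] at h2
    omega
  have h1 := Submodule.finrank_lt_finrank_of_lt hlt1
  have h2 := Submodule.finrank_lt_finrank_of_lt hlt2
  have h3 := hf.2
  have h4 := hg.2
  omega

end Cones

/-! ### Pulling triangulations in the cone setting -/

/-- The list `l` consists of points of the convex hull of `T` and contains all points of `T`, which
lie in the hyperplane `w = 1`. -/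
structure IsPointList {d : ℕ} (w : Dual ℝ (Space d)) (T : Set (Space d))
    (l : List (Space d)) : Prop where
  eq_one : ∀ t ∈ T, w t = 1
  mem_list : ∀ t ∈ T, t ∈ l
  mem_hull : ∀ x ∈ l, x ∈ convexHull ℝ T

section Pulling

variable {d : ℕ} {w f : Dual ℝ (Space d)} {T σ P : Set (Space d)} {l : List (Space d)}
  {p : Space d}

open Classical in
theorem IsPointList.filter (h : IsPointList w T l) :
    IsPointList w (zeroSet T f) (l.filter fun x => x ∈ convexHull ℝ (zeroSet T f)) where
  eq_one t ht := h.eq_one t ht.1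
  mem_list t ht := by
    rw [List.mem_filter]
    exact ⟨h.mem_list t ht.1, by simpa using subset_convexHull ℝ _ ht⟩
  mem_hull x hx := by
    rw [List.mem_filter] at hx
    simpa using hx.2

theorem IsPullingSimplex.subset (h : IsPullingSimplex P l σ) : ∀ x ∈ σ, x ∈ l := by
  induction h with
  | simplex P p l hind => exact fun x hx => hx
  | pull P p l hdep F hF hp σ hσ ih =>
    rintro x (rfl | hx)
    · exact List.mem_cons_self
    · exact List.mem_of_mem_filter (ih x hx)

theorem IsPullingSimplex.head_mem (h : IsPullingSimplex P (p :: l) σ) : p ∈ σ := by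
  cases h with
  | simplex => exact List.mem_cons_self
  | pull => exact Set.mem_insert _ _

/-- Applying `w` to a linear relation shows that its coefficients sum to zero. -/
theorem linearIndependent_of_affineIndependent {ι : Type*} {v : ι → Space d}
    (hw : ∀ i, w (v i) = 1) (hv : AffineIndependent ℝ v) : LinearIndependent ℝ v := by
  rw [linearIndependent_iff']
  intro s g hg
  refine affineIndependent_iff.1 hv s g ?_ hg
  have := congrArg w hg
  simpa [map_sum, hw] using this

theorem IsFacetFunctional.pos_of_notMem (h : IsPointList w T (p :: l))
    (hf : IsFacetFunctional T f) (hp : p ∉ convexHull ℝ (zeroSet T f)) : 0 < f p := by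
  have hpT := h.mem_hull p List.mem_cons_self
  refine lt_of_le_of_ne (nonneg_of_mem_hull hf.1 (convexHull_subset_hull hpT)) fun h0 => hp ?_
  exact (mem_convexHull_zeroSet_iff h.eq_one hf.1).2 ⟨hpT, h0.symm⟩

open Classical in
/-- Induction over the simplices of the pulling triangulation of the convex hull of `T`. -/
theorem IsPullingSimplex.induction_convexHull
    {motive : Set (Space d) → List (Space d) → Set (Space d) → Prop}
    (simplex : ∀ T p l, IsPointList w T (p :: l) → LinearIndepOn ℝ id {x | x ∈ p :: l} →
      motive T (p :: l) {x | x ∈ p :: l})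
    (pull : ∀ T p l f σ, IsPointList w T (p :: l) → IsFacetFunctional T f →
      (zeroSet T f).Nonempty → 0 < f p →
      IsPullingSimplex (convexHull ℝ (zeroSet T f))
        ((p :: l).filter fun x => x ∈ convexHull ℝ (zeroSet T f)) σ →
      motive (zeroSet T f) ((p :: l).filter fun x => x ∈ convexHull ℝ (zeroSet T f)) σ →
      motive T (p :: l) (insert p σ))
    (hl : IsPointList w T l) (h : IsPullingSimplex (convexHull ℝ T) l σ) : motive T l σ := by
  generalize hP : convexHull ℝ T = P at h
  induction h generalizing T with
  | simplex P p l hind =>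
    refine simplex T p l hl ?_
    have := (linearIndependent_of_affineIndependent
      (fun i => eq_one_of_mem_convexHull hl.eq_one (hl.mem_hull _ (List.get_mem _ i)))
      hind).linearIndepOn_id
    rwa [Set.range_list_get] at this
  | pull P p l hdep F hF hp σ hσ ih =>
    subst hP
    obtain ⟨f, hf, hne, rfl⟩ := (isFacet_convexHull_iff hl.eq_one).1 hF
    exact pull T p l f σ hl hf hne (hf.pos_of_notMem hl hp) hσ (ih (hl.filter) rfl)

theorem IsPullingSimplex.subset_convexHull (hl : IsPointList w T l)
    (h : IsPullingSimplex (convexHull ℝ T) l σ) : σ ⊆ convexHull ℝ T :=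
  fun x hx => hl.mem_hull x (h.subset x hx)

theorem IsPullingSimplex.linearIndepOn (hl : IsPointList w T l)
    (h : IsPullingSimplex (convexHull ℝ T) l σ) :
    LinearIndepOn ℝ id σ ∧ Submodule.span ℝ σ = Submodule.span ℝ T := by
  refine IsPullingSimplex.induction_convexHull
    (motive := fun T _ σ => LinearIndepOn ℝ id σ ∧ Submodule.span ℝ σ = Submodule.span ℝ T)
    ?_ ?_ hl h
  · intro T p l hl hind
    refine ⟨hind, le_antisymm ?_ (Submodule.span_mono hl.mem_list)⟩
    exact Submodule.span_le.2 fun x hx => convexHull_subset_span (hl.mem_hull x hx)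
  · rintro T p l f σ hl hf - hfp - ⟨h1, h2⟩
    refine ⟨h1.id_insert fun hp => hfp.ne' (vanish_on_span (h2 ▸ hp)), ?_⟩
    rw [← hf.span_insert (convexHull_subset_span (hl.mem_hull p List.mem_cons_self)) hfp.ne',
      Submodule.span_insert, h2, ← Submodule.span_insert]

/-- The simplices of a pulling triangulation cover the cone. -/
theorem exists_isPullingSimplex_mem_hull (hT : T.Finite) (hne : T.Nonempty)
    (hl : IsPointList w T l) (hnd : l.Nodup) {b : Space d} (hb : b ∈ PointedCone.hull ℝ T) :
    ∃ σ, IsPullingSimplex (convexHull ℝ T) l σ ∧ b ∈ PointedCone.hull ℝ σ := by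
  classical
  induction hk : finrank ℝ (Submodule.span ℝ T) using Nat.strong_induction_on
    generalizing T l b with
  | _ k ih =>
  obtain ⟨t₀, ht₀⟩ := hne
  obtain ⟨p, l, rfl⟩ := List.exists_cons_of_ne_nil (List.ne_nil_of_mem (hl.mem_list t₀ ht₀))
  by_cases hind : AffineIndependent ℝ (fun i => (p :: l).get i)
  · exact ⟨_, .simplex _ p l hind, Submodule.span_mono hl.mem_list hb⟩
  have hpT := hl.mem_hull p List.mem_cons_self
  obtain ⟨f, hf, hfp, c, hc, hmem⟩ := exists_exit_facet hT hl.eq_one hpT hb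
  -- Otherwise `T` spans only the line of `p`, so the duplicate-free list is `[p]`, which is
  -- affinely independent.
  have hzne : (zeroSet T f).Nonempty := by
    rw [Set.nonempty_iff_ne_empty]
    intro hz
    have hspan := hf.span_insert (convexHull_subset_span hpT) hfp.ne'
    rw [hz, insert_empty_eq] at hspan
    have hall : ∀ x ∈ p :: l, x = p := fun x hx => by
      have hxT := hl.mem_hull x hx
      have := convexHull_subset_span hxT
      rw [← hspan, Submodule.mem_span_singleton] at this
      obtain ⟨a, rfl⟩ := this
      have h1 := eq_one_of_mem_convexHull hl.eq_one hxT
      rw [map_smul, eq_one_of_mem_convexHull hl.eq_one hpT] at h1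
      simp at h1
      simp [h1]
    have hnil : l = [] := by
      rw [List.eq_nil_iff_forall_not_mem]
      intro x hx
      have := hall x (List.mem_cons_of_mem _ hx)
      subst this
      exact (List.nodup_cons.1 hnd).1 hx
    subst hnil
    have : Subsingleton (Fin [p].length) := inferInstanceAs (Subsingleton (Fin 1))
    exact hind (affineIndependent_of_subsingleton ℝ _)
  have := hf.2
  obtain ⟨σ, hσ, hbσ⟩ := ih _ (by omega) (hT.subset zeroSet_subset) hzne (hl.filter)
    (hnd.filter _) hmem rfl
  refine ⟨insert p σ, .pull _ p l hind _
    ((isFacet_convexHull_iff hl.eq_one).2 ⟨f, hf, hzne, rfl⟩) ?_ σ hσ, ?_⟩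
  · intro hp
    exact hfp.ne' ((mem_convexHull_zeroSet_iff hl.eq_one hf.1).1 hp).2
  · have : b = c • p + (b - c • p) := by abel
    rw [this]
    exact add_mem (smul_mem_hull (Submodule.subset_span (Set.mem_insert _ _)) hc)
      (Submodule.span_mono (Set.subset_insert _ _) hbσ)

end Pulling

/-! ### Comparing simplex volumes by determinants -/

section Volume

variable {d k : ℕ}

/-- Replace column `0` by the sum of all columns, which is all ones, subtract row `0` from the
others, and expand along column `0`. -/
theorem det_eq_det_differences (M : Matrix (Fin (k + 1)) (Fin (k + 1)) ℝ)
    (hM : ∀ i, ∑ j, M i j = 1) :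
    M.det = (Matrix.of fun i j : Fin k => M i.succ j.succ - M 0 j.succ).det := by
  have h1 : M.det = (M.updateCol 0 fun _ => 1).det := by
    have := Matrix.det_updateCol_sum M 0 (fun _ => (1 : ℝ))
    simpa [hM] using this.symm
  rw [h1]
  let B : Matrix (Fin (k + 1)) (Fin (k + 1)) ℝ := Fin.cons (M.updateCol 0 (fun _ => 1) 0)
    fun i j => M.updateCol 0 (fun _ => 1) i.succ j - M.updateCol 0 (fun _ => 1) 0 j
  have h2 : (M.updateCol 0 fun _ => 1).det = B.det := by
    refine Matrix.det_eq_of_forall_row_eq_smul_add_const (Fin.cons 0 fun _ => 1) 0 rfl ?_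
    intro i j
    refine Fin.cases ?_ (fun i => ?_) i
    · simp [B]
    · simp [B]
  rw [h2, Matrix.det_succ_column_zero, Fin.sum_univ_succ]
  simp only [B, Matrix.updateCol_apply, Fin.cons_zero, Fin.cons_succ]
  simp
  rfl

/-- The edge matrices differ by the matrix of differences of `M`, so the Gram determinant scales by
its squared determinant. -/
theorem simplexVolume_eq_abs_det_mul (s t : Affine.Simplex ℝ (Space d) k)
    (M : Matrix (Fin (k + 1)) (Fin (k + 1)) ℝ) (hM : ∀ i, ∑ j, M i j = 1)
    (h : ∀ i, t.points i = ∑ j, M i j • s.points j) :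
    simplexVolume t = |M.det| * simplexVolume s := by
  let E : Affine.Simplex ℝ (Space d) k → Matrix (Fin k) (Fin d) ℝ :=
    fun s => Matrix.of fun i => s.points i.succ - s.points 0
  have hE : ∀ s : Affine.Simplex ℝ (Space d) k, (Matrix.of fun i j : Fin k =>
      (s.points i.succ - s.points 0) ⬝ᵥ (s.points j.succ - s.points 0)) = E s * (E s).transpose := by
    intro s; ext i j; rfl
  let N : Matrix (Fin k) (Fin k) ℝ := Matrix.of fun i j => M i.succ j.succ - M 0 j.succ
  have hEt : E t = N * E s := by
    ext i c
    have e1 : ∀ i, t.points i - s.points 0 = ∑ j, M i j • (s.points j - s.points 0) := by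
      intro i
      simp_rw [smul_sub, Finset.sum_sub_distrib, ← Finset.sum_smul, hM, one_smul, h]
    have : t.points i.succ - t.points 0
        = ∑ j : Fin k, (M i.succ j.succ - M 0 j.succ) • (s.points j.succ - s.points 0) := by
      have : t.points i.succ - t.points 0
          = (t.points i.succ - s.points 0) - (t.points 0 - s.points 0) := by abel
      rw [this, e1, e1, ← Finset.sum_sub_distrib, Fin.sum_univ_succ]
      simp [sub_smul]
    simp only [E, N, Matrix.mul_apply, Matrix.of_apply]
    rw [this]
    simp
  rw [simplexVolume, simplexVolume, hE, hE, hEt, Matrix.transpose_mul, Matrix.mul_assoc,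
    ← Matrix.mul_assoc (E s), Matrix.det_mul, Matrix.det_mul, Matrix.det_transpose,
    det_eq_det_differences M hM]
  change √(N.det * (_ * N.det)) / _ = |N.det| * _
  rw [show N.det * ((E s * (E s).transpose).det * N.det)
    = N.det ^ 2 * (E s * (E s).transpose).det by ring, Real.sqrt_mul (sq_nonneg _),
    Real.sqrt_sq_eq_abs, mul_div_assoc]

theorem simplexVolume_pos (s : Affine.Simplex ℝ (Space d) k) : 0 < simplexVolume s := by
  have hli : LinearIndependent ℝ (fun i : Fin k => s.points i.succ - s.points 0) := by
    have := (affineIndependent_iff_linearIndependent_vsub ℝ s.points 0).1 s.independent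
    exact this.comp (fun i : Fin k => (⟨i.succ, Fin.succ_ne_zero i⟩ : {x : Fin (k + 1) // x ≠ 0}))
      fun i j h => by simpa using h
  let E : Matrix (Fin k) (Fin d) ℝ := Matrix.of fun i => s.points i.succ - s.points 0
  have hE : Function.Injective E.vecMul := Matrix.vecMul_injective_iff.2 hli
  have := (Matrix.PosDef.mul_conjTranspose_self E hE).det_pos
  rw [simplexVolume]
  refine div_pos (Real.sqrt_pos.2 ?_) (by positivity)
  exact this

/-- The transition matrix is integral with nonzero determinant, hence of determinant at least `1` in
absolute value. -/
theorem simplexVolume_le_of_int_combination (s t : Affine.Simplex ℝ (Space d) k)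
    {w : Dual ℝ (Space d)} (hs : ∀ i, w (s.points i) = 1) (ht : ∀ i, w (t.points i) = 1)
    (h : ∀ i, t.points i ∈ Submodule.span ℤ (Set.range s.points)) :
    simplexVolume s ≤ simplexVolume t := by
  choose N hN using fun i => (Submodule.mem_span_range_iff_exists_fun ℤ).1 (h i)
  let N' : Matrix (Fin (k + 1)) (Fin (k + 1)) ℤ := Matrix.of N
  let M : Matrix (Fin (k + 1)) (Fin (k + 1)) ℝ := N'.map (Int.castRingHom ℝ)
  have hMt : ∀ i, t.points i = ∑ j, M i j • s.points j := fun i => by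
    rw [← hN i]
    exact Finset.sum_congr rfl fun j _ => (Int.cast_smul_eq_zsmul ℝ (N i j) _).symm
  have hM : ∀ i, ∑ j, M i j = 1 := fun i => by
    have := congrArg w (hMt i)
    simpa [map_sum, hs, ht] using this.symm
  rw [simplexVolume_eq_abs_det_mul s t M hM hMt]
  have hdet : M.det ≠ 0 := by
    intro h0
    have h1 := simplexVolume_eq_abs_det_mul s t M hM hMt
    have := simplexVolume_pos t
    rw [h1, h0] at this
    simp at this
  have : M.det = (N'.det : ℝ) := by
    simp only [M]
    rw [← RingHom.mapMatrix_apply, ← RingHom.map_det]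
    rfl
  rw [this] at hdet ⊢
  have h1 : (1 : ℝ) ≤ |(N'.det : ℝ)| := by
    have : N'.det ≠ 0 := by exact_mod_cast hdet
    exact_mod_cast Int.one_le_abs this
  nlinarith [simplexVolume_pos s]

theorem exists_simplex_range_eq {σ : Set (Space d)} (hσ : LinearIndepOn ℝ id σ)
    (hk : finrank ℝ (Submodule.span ℝ σ) = k + 1) :
    ∃ s : Affine.Simplex ℝ (Space d) k, Set.range s.points = σ := by
  have hfin : σ.Finite := hσ.setFinite
  have := hfin.fintype
  have hcard : Fintype.card σ = k + 1 := by
    rw [← hk, finrank_span_set_eq_card hσ, Set.toFinset_card]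
  let e := (Fintype.equivFinOfCardEq hcard).symm
  have hli : LinearIndependent ℝ (fun x : σ => (x : Space d)) := hσ
  refine ⟨⟨fun i => (e i : Space d), (hli.comp e e.injective).affineIndependent⟩, ?_⟩
  change Set.range (Subtype.val ∘ e) = σ
  rw [e.surjective.range_comp, Subtype.range_coe]

/-- If replacing the vertex `p` of a simplex by `q` does not lower its volume, then the distance of
`q` from the opposite facet is at least that of `p`. -/
theorem abs_le_abs_of_simplexVolume_minimal (s : Affine.Simplex ℝ (Space d) k)
    {w f : Dual ℝ (Space d)} {C σ : Set (Space d)} (hC : ∀ x ∈ C, w x = 1)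
    (hsC : Set.range s.points ⊆ C)
    (hmin : ∀ t : Affine.Simplex ℝ (Space d) k, Set.range t.points ⊆ C →
      simplexVolume s ≤ simplexVolume t)
    {p q : Space d} (hs : Set.range s.points = insert p σ) (hσ : ∀ x ∈ σ, f x = 0)
    (hq : q ∈ C) (hqs : q ∈ Submodule.span ℝ (Set.range s.points)) (hfq : f q ≠ 0) :
    |f p| ≤ |f q| := by
  obtain ⟨i₀, hi₀⟩ : p ∈ Set.range s.points := hs ▸ Set.mem_insert p σ
  obtain ⟨c, hc⟩ := (Submodule.mem_span_range_iff_exists_fun ℝ).1 hqs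
  have hws : ∀ i, w (s.points i) = 1 := fun i => hC _ (hsC ⟨i, rfl⟩)
  have hfs : ∀ j, j ≠ i₀ → f (s.points j) = 0 := fun j hj => by
    have : s.points j ∈ insert p σ := hs ▸ ⟨j, rfl⟩
    rcases this with h | h
    · exact absurd (s.independent.injective (h.trans hi₀.symm)) hj
    · exact hσ _ h
  have hfq' : f q = c i₀ * f p := by
    rw [← hc, map_sum, Finset.sum_eq_single i₀]
    · simp [hi₀]
    · intro j _ hj; simp [hfs j hj]
    · simp
  have hsum : ∑ j, c j = 1 := by
    have := congrArg w hc
    simpa [map_sum, hws, hC q hq] using this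
  have hc0 : c i₀ ≠ 0 := by
    intro h; rw [h, zero_mul] at hfq'; exact hfq hfq'
  -- Exchanging `p` for `q` scales the volume by the barycentric coordinate `c i₀`, and `f q = c i₀
  -- * f p`.
  let M : Matrix (Fin (k + 1)) (Fin (k + 1)) ℝ := (1 : Matrix _ _ ℝ).updateRow i₀ c
  have hMdet : M.det = c i₀ := by
    have := Matrix.det_updateRow_sum (1 : Matrix (Fin (k + 1)) (Fin (k + 1)) ℝ) i₀ c
    have e : (∑ j, c j • (1 : Matrix (Fin (k + 1)) (Fin (k + 1)) ℝ) j) = c := by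
      ext j; simp [Matrix.one_apply]
    rw [e] at this
    simpa [M] using this
  have hMsum : ∀ i, ∑ j, M i j = 1 := by
    intro i
    by_cases h : i = i₀
    · subst h; simpa [M] using hsum
    · simp [M, h, Matrix.one_apply]
  have hMt : ∀ i, Function.update s.points i₀ q i = ∑ j, M i j • s.points j := by
    intro i
    by_cases h : i = i₀
    · subst h; simpa [M] using hc.symm
    · simp [M, h, Matrix.one_apply]
  have hli : LinearIndependent ℝ (Function.update s.points i₀ q) := by
    rw [Fintype.linearIndependent_iff]
    intro g hg
    have hsl := linearIndependent_of_affineIndependent hws s.independent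
    rw [Fintype.linearIndependent_iff] at hsl
    have h0 : Matrix.vecMul g M = 0 := by
      ext j
      refine hsl (Matrix.vecMul g M) ?_ j
      rw [← hg]
      simp_rw [hMt, Finset.smul_sum, smul_smul]
      rw [Finset.sum_comm]
      refine Finset.sum_congr rfl fun j _ => ?_
      rw [← Finset.sum_smul]; rfl
    have := Matrix.eq_zero_of_vecMul_eq_zero (by rw [hMdet]; exact hc0) h0
    intro i; rw [this]; rfl
  let t : Affine.Simplex ℝ (Space d) k := ⟨_, hli.affineIndependent⟩
  have hle := hmin t (by
    rintro _ ⟨i, rfl⟩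
    change Function.update s.points i₀ q i ∈ C
    by_cases h : i = i₀
    · subst h; simpa using hq
    · simpa [h] using hsC ⟨i, rfl⟩)
  rw [simplexVolume_eq_abs_det_mul s t M hMsum hMt, hMdet] at hle
  have h1 : 1 ≤ |c i₀| := by
    by_contra! h
    nlinarith [simplexVolume_pos s]
  rw [hfq', abs_mul]
  nlinarith [abs_nonneg (f p)]

end Volume

/-! ### Rounding up implies compressed -/

/-- Whenever an element of the semigroup generated by `S` has a real representation with coefficient
`a` at `p ∈ S`, it has an integral one whose coefficient at `p` is at least `a`. -/
def RoundsUp {d : ℕ} (S : Set (Space d)) : Prop :=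
  ∀ b ∈ AddSubmonoid.closure S, ∀ p ∈ S, ∀ a : ℝ, 0 ≤ a → ∀ c ∈ PointedCone.hull ℝ S,
    b = a • p + c → ∃ m : ℕ, a ≤ m ∧ ∃ c' ∈ AddSubmonoid.closure S, b = m • p + c'

section Forward

variable {d : ℕ} {S T σ : Set (Space d)} {w : Dual ℝ (Space d)} {l : List (Space d)}

theorem closure_subset_hull {x : Space d} (hx : x ∈ AddSubmonoid.closure S) :
    x ∈ PointedCone.hull ℝ S := by
  have : AddSubmonoid.closure S ≤ (PointedCone.hull ℝ S).toAddSubmonoid :=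
    (AddSubmonoid.closure_le).2 Submodule.subset_span
  exact this hx

theorem closure_subset_span_int {x : Space d} (hx : x ∈ AddSubmonoid.closure S) :
    x ∈ Submodule.span ℤ S := by
  have : AddSubmonoid.closure S ≤ (Submodule.span ℤ S).toAddSubmonoid :=
    (AddSubmonoid.closure_le).2 Submodule.subset_span
  exact this hx

theorem exists_add_mem_closure {q : Space d} (hq : q ∈ Submodule.span ℤ S) :
    ∃ a ∈ AddSubmonoid.closure S, q + a ∈ AddSubmonoid.closure S := by
  induction hq using Submodule.closure_induction with
  | zero => exact ⟨0, zero_mem _, by simp⟩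
  | add x y _ _ hx hy =>
    obtain ⟨a, ha, hxa⟩ := hx
    obtain ⟨b, hb, hyb⟩ := hy
    refine ⟨a + b, add_mem ha hb, ?_⟩
    rw [add_add_add_comm]
    exact add_mem hxa hyb
  | smul_mem r x hx =>
    have hx' := AddSubmonoid.subset_closure (s := S) hx
    refine ⟨r.natAbs • x, nsmul_mem hx' _, ?_⟩
    have h0 : 0 ≤ r + r.natAbs := by omega
    obtain ⟨m, hm⟩ := Int.eq_ofNat_of_zero_le h0
    have : r • x + r.natAbs • x = m • x := by
      rw [← natCast_zsmul x r.natAbs, ← add_smul, hm, natCast_zsmul]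
    rw [this]
    exact nsmul_mem hx' _

/-- Rounding up `q + p = 1 • p + q` gives an integral representation with at least one `p`, which
can be cancelled. Generators are removed one by one. -/
theorem RoundsUp.mem_closure_of_add_mem (h : RoundsUp S) {a : Space d}
    (ha : a ∈ AddSubmonoid.closure S) : ∀ q ∈ PointedCone.hull ℝ S,
      q + a ∈ AddSubmonoid.closure S → q ∈ AddSubmonoid.closure S := by
  induction ha using AddSubmonoid.closure_induction with
  | mem p hp =>
    intro q hq hqp
    obtain ⟨m, hm, c, hc, e⟩ := h _ hqp p hp 1 zero_le_one q hq (by rw [one_smul, add_comm])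
    obtain ⟨k, rfl⟩ : ∃ k, m = k + 1 := Nat.exists_eq_add_of_le' (by exact_mod_cast hm)
    have : q = k • p + c := by
      rw [add_smul, one_smul] at e
      have : q + p = (k • p + c) + p := by rw [e]; abel
      exact add_right_cancel this
    rw [this]
    exact add_mem (nsmul_mem (AddSubmonoid.subset_closure hp) _) hc
  | zero => intro q _ h; simpa using h
  | add a a' ha ha' iha iha' =>
    intro q hq hqa
    refine iha q hq (iha' (q + a) (add_mem hq (closure_subset_hull ha)) ?_)
    rwa [add_assoc]

theorem RoundsUp.mem_closure (h : RoundsUp S) {q : Space d} (hL : q ∈ Submodule.span ℤ S)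
    (hq : q ∈ PointedCone.hull ℝ S) : q ∈ AddSubmonoid.closure S := by
  obtain ⟨a, ha, hqa⟩ := exists_add_mem_closure hL
  exact h.mem_closure_of_add_mem ha q hq hqa

/-- `w` counts the generators in a sum. -/
theorem mem_of_mem_closure_of_eq_one (hw : ∀ t ∈ S, w t = 1) {x : Space d}
    (hx : x ∈ AddSubmonoid.closure S) (h1 : w x = 1) : x ∈ S := by
  have : ∃ k : ℕ, w x = k ∧ (k = 0 → x = 0) ∧ (k = 1 → x ∈ S) := by
    clear h1
    induction hx using AddSubmonoid.closure_induction with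
    | mem x hx => exact ⟨1, by simp [hw x hx], by simp, fun _ => hx⟩
    | zero => exact ⟨0, by simp, by simp, by simp⟩
    | add x y _ _ ihx ihy =>
      obtain ⟨k, hk, hk0, hk1⟩ := ihx
      obtain ⟨m, hm, hm0, hm1⟩ := ihy
      refine ⟨k + m, by simp [hk, hm], fun h => ?_, fun h => ?_⟩
      · rw [hk0 (by omega), hm0 (by omega), add_zero]
      · rcases Nat.eq_zero_or_pos k with h' | h'
        · rw [hk0 h', zero_add]; exact hm1 (by omega)
        · rw [hm0 (by omega), add_zero]; exact hk1 (by omega)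
  obtain ⟨k, hk, -, hk1⟩ := this
  exact hk1 (by rw [h1] at hk; exact_mod_cast hk.symm)

theorem RoundsUp.mem_of_mem_convexHull (h : RoundsUp S) (hw : ∀ t ∈ S, w t = 1) {q : Space d}
    (hL : q ∈ Submodule.span ℤ S) (hq : q ∈ convexHull ℝ S) : q ∈ S :=
  mem_of_mem_closure_of_eq_one hw (h.mem_closure hL (convexHull_subset_hull hq))
    (eq_one_of_mem_convexHull hw hq)

theorem RoundsUp.mem_closure_simplex (h : RoundsUp S) (hwS : ∀ t ∈ S, w t = 1)
    (hl : IsPointList w S l) (hlS : ∀ x ∈ l, x ∈ S)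
    (hσ : IsPullingSimplex (convexHull ℝ S) l σ) {b : Space d}
    (hb : b ∈ AddSubmonoid.closure S) (hbσ : b ∈ PointedCone.hull ℝ σ) :
    b ∈ AddSubmonoid.closure σ := by
  classical
  refine IsPullingSimplex.induction_convexHull
    (motive := fun T l σ => (∀ x ∈ l, x ∈ S) → (∀ x ∈ S, x ∈ convexHull ℝ T → x ∈ l) →
      -- The cone of `T` stays a face with respect to the semigroup, so summands of its elements
      -- remain in it.
      (∀ x ∈ AddSubmonoid.closure S, ∀ y ∈ AddSubmonoid.closure S,
        x + y ∈ PointedCone.hull ℝ T → x ∈ PointedCone.hull ℝ T ∧ y ∈ PointedCone.hull ℝ T) →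
      ∀ b ∈ AddSubmonoid.closure S, b ∈ PointedCone.hull ℝ σ → b ∈ AddSubmonoid.closure σ)
    ?_ ?_ hl hσ hlS (fun x hx _ => hl.mem_list x hx)
    (fun x hx y hy _ => ⟨closure_subset_hull hx, closure_subset_hull hy⟩) b hb hbσ
  · intro T p l hl _ _ hSl hface b hb hbσ
    replace hbσ := hull_le_of_subset_convexHull hl.mem_hull hbσ
    induction hb using AddSubmonoid.closure_induction with
    | mem x hx =>
      exact AddSubmonoid.subset_closure
        (hSl x hx (mem_convexHull_of_mem_hull hl.eq_one hbσ (hwS x hx)))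
    | zero => exact zero_mem _
    | add x y hx hy ihx ihy =>
      obtain ⟨h1, h2⟩ := hface x hx y hy hbσ
      exact add_mem (ihx h1) (ihy h2)
  · intro T p l f σ hl hf _ hfp hσ ih hlS hSl hface b hb hbσ
    have hpS := hlS p List.mem_cons_self
    obtain ⟨a, c, hc, e⟩ := Submodule.mem_span_insert.1 hbσ
    have hcZ : c ∈ PointedCone.hull ℝ (zeroSet T f) :=
      hull_le_of_subset_convexHull (hσ.subset_convexHull hl.filter) hc
    have hcT : c ∈ PointedCone.hull ℝ T := Submodule.span_mono zeroSet_subset hcZ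
    have hpT := convexHull_subset_hull (hl.mem_hull p List.mem_cons_self)
    have hTS : T ⊆ S := fun t ht => hlS t (hl.mem_list t ht)
    obtain ⟨m, hm, c', hc', e'⟩ := h b hb p hpS a a.2 c (Submodule.span_mono hTS hcT) e
    have hbT : m • p + c' ∈ PointedCone.hull ℝ T := by
      rw [← e', e]; exact add_mem (Submodule.smul_mem _ _ hpT) hcT
    have hc'T := (hface _ (nsmul_mem (AddSubmonoid.subset_closure hpS) m) c' hc' hbT).2
    -- `f` vanishes at `c` and is nonnegative at `c'`, so `m` cannot exceed `a`; the coefficient `a`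
    -- was already integral.
    have hfb : (a : ℝ) * f p = m * f p + f c' := by
      have h1 : b = (a : ℝ) • p + c := e
      have := congrArg f (h1.symm.trans e')
      rw [map_add, map_add, map_smul, map_nsmul, vanish_on_hull hcZ, add_zero] at this
      simpa using this
    have hfc' := nonneg_of_mem_hull hf.1 hc'T
    have ham : (a : ℝ) = m := le_antisymm hm (by nlinarith)
    have hcc : c = c' := by
      have h1 : (a : ℝ) • p + c = m • p + c' := (e.symm.trans e' :)
      rw [ham, Nat.cast_smul_eq_nsmul] at h1
      exact add_left_cancel h1
    subst hcc
    rw [e']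
    refine add_mem (nsmul_mem (AddSubmonoid.subset_closure (Set.mem_insert _ _)) _)
      (AddSubmonoid.closure_mono (Set.subset_insert _ _) (ih ?_ ?_ ?_ c hc' hc))
    · exact fun x hx => hlS x (List.mem_of_mem_filter hx)
    · intro x hx hxc
      rw [List.mem_filter]
      exact ⟨hSl x hx (convexHull_mono zeroSet_subset hxc), by simpa using hxc⟩
    · intro x hx y hy hxy
      obtain ⟨h1, h2⟩ := hface x hx y hy (Submodule.span_mono zeroSet_subset hxy)
      have h0 := vanish_on_hull hxy
      rw [map_add] at h0
      have h3 := nonneg_of_mem_hull hf.1 h1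
      have h4 := nonneg_of_mem_hull hf.1 h2
      exact ⟨mem_hull_zeroSet hf.1 h1 (by linarith), mem_hull_zeroSet hf.1 h2 (by linarith)⟩

theorem exists_add_nsmul_sum_mem_hull (τ : Finset (Space d)) {a : Space d}
    (ha : a ∈ Submodule.span ℝ (τ : Set (Space d))) :
    ∃ m : ℕ, a + m • ∑ x ∈ τ, x ∈ PointedCone.hull ℝ (τ : Set (Space d)) := by
  obtain ⟨g, -, rfl⟩ := Submodule.mem_span_finset.1 ha
  obtain ⟨m, hm⟩ := exists_nat_ge (∑ x ∈ τ, |g x|)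
  refine ⟨m, ?_⟩
  rw [Finset.smul_sum, ← Finset.sum_add_distrib]
  refine sum_mem fun x hx => ?_
  rw [← Nat.cast_smul_eq_nsmul ℝ, ← add_smul]
  refine smul_mem_hull (Submodule.subset_span hx) ?_
  have h1 := Finset.single_le_sum (f := fun x => |g x|) (fun i _ => abs_nonneg _) hx
  have h2 := neg_abs_le (g x)
  linarith

theorem RoundsUp.isCompressed (h : RoundsUp S) (hw : ∀ t ∈ S, w t = 1) :
    IsCompressed (Submodule.span ℤ S) (convexHull ℝ S) := by
  intro l _ hl σ hσ
  replace hσ : IsPullingSimplex (convexHull ℝ S) l σ := hσ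
  have hlS : ∀ x ∈ l, x ∈ S := fun x hx =>
    h.mem_of_mem_convexHull hw ((hl x).1 hx).1 ((hl x).1 hx).2
  have hpl : IsPointList w S l :=
    ⟨hw, fun t ht => (hl t).2 ⟨Submodule.subset_span ht, subset_convexHull ℝ _ ht⟩,
      fun x hx => ((hl x).1 hx).2⟩
  have hσS : σ ⊆ S := fun x hx => hlS x (hσ.subset x hx)
  obtain ⟨hind, hspan⟩ := hσ.linearIndepOn hpl
  have hne : S.Nonempty := by
    cases hσ with
    | simplex _ p l _ => exact ⟨p, hlS p List.mem_cons_self⟩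
    | pull _ p l _ _ _ _ _ _ => exact ⟨p, hlS p List.mem_cons_self⟩
  have hSσ : Submodule.span ℤ S ≤ Submodule.span ℤ σ := by
    rw [Submodule.span_le]
    intro a ha
    have hfin : σ.Finite := hind.setFinite
    obtain ⟨τ, rfl⟩ := hfin.exists_finset_coe
    -- Adding a large multiple of the vertex sum moves `a` into the cone of the simplex; subtracting
    -- it afterwards leaves an integral combination.
    obtain ⟨m, hm⟩ := exists_add_nsmul_sum_mem_hull τ (hspan ▸ Submodule.subset_span ha)
    have hsum : ∀ U : Set (Space d), (τ : Set (Space d)) ⊆ U →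
        m • ∑ x ∈ τ, x ∈ AddSubmonoid.closure U := fun U hU =>
      nsmul_mem (sum_mem fun x hx => AddSubmonoid.subset_closure (hU hx)) m
    have h1 := h.mem_closure_simplex hw hpl hlS hσ
      (add_mem (AddSubmonoid.subset_closure ha) (hsum S hσS)) hm
    have := sub_mem (closure_subset_span_int h1) (closure_subset_span_int (hsum τ subset_rfl))
    simpa using this
  obtain ⟨s, hs⟩ := exists_simplex_range_eq hind
    (hspan ▸ finrank_span_eq_convDim_add_one hw hne)
  refine ⟨s, hs, fun t ht => ?_⟩
  refine simplexVolume_le_of_int_combination s t (w := w)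
    (fun i => hw _ (hσS (hs ▸ ⟨i, rfl⟩)))
    (fun i => eq_one_of_mem_convexHull hw (ht ⟨i, rfl⟩).2) fun i => ?_
  rw [hs]
  exact hSσ (ht ⟨i, rfl⟩).1

end Forward

/-! ### Compressed implies rounding up, through two-level facets -/

/-- Each facet of the convex hull of `T` is cut out by a functional that is integral on `L` and
equal to `1` at the points of `L` off the facet. -/
def IsTwoLevel {d : ℕ} (L : Submodule ℤ (Space d)) (T : Set (Space d)) : Prop :=
  ∀ f, IsFacetFunctional T f → ∃ h : Dual ℝ (Space d), (∀ x ∈ L, ∃ m : ℤ, h x = m) ∧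
    ∀ x ∈ L, x ∈ convexHull ℝ T → (f x = 0 → h x = 0) ∧ (f x ≠ 0 → h x = 1)

section Backward

variable {d : ℕ} {S T σ : Set (Space d)} {w f : Dual ℝ (Space d)} {l : List (Space d)}
  {L : Submodule ℤ (Space d)}

/-- A facet of a facet is cut out by a facet of `T`, whose integral functional serves again. -/
theorem IsTwoLevel.zeroSet (hT : T.Finite) (h : IsTwoLevel L T) (hf : IsFacetFunctional T f) :
    IsTwoLevel L (zeroSet T f) := by
  intro g hg
  obtain ⟨k, hk, hkg⟩ := hf.exists_extend hT hg
  obtain ⟨u, hu, hux⟩ := h k hk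
  refine ⟨u, hu, fun x hx hxc => ?_⟩
  rw [← hkg x (convexHull_subset_span hxc)]
  exact hux x hx (convexHull_mono zeroSet_subset hxc)

theorem isFacetFunctional_of_linearIndepOn (hind : LinearIndepOn ℝ id T) {q : Space d}
    (hq : q ∈ T) (hfq : f q = 1) (hf : ∀ x ∈ T, x ≠ q → f x = 0) : IsFacetFunctional T f := by
  have hz : zeroSet T f = T \ {q} := by
    ext x
    constructor
    · rintro ⟨h1, h2⟩
      refine ⟨h1, ?_⟩
      rintro rfl
      rw [hfq] at h2
      exact one_ne_zero h2
    · rintro ⟨h1, h2⟩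
      exact ⟨h1, hf x h1 h2⟩
  refine ⟨fun t ht => ?_, ?_⟩
  · by_cases h : t = q
    · rw [h, hfq]; exact zero_le_one
    · rw [hf t ht h]
  · have hfin : T.Finite := hind.setFinite
    have := hfin.fintype
    have := (hfin.subset (Set.sdiff_subset (t := {q}))).fintype
    rw [hz, finrank_span_set_eq_card hind,
      finrank_span_set_eq_card (hind.mono Set.sdiff_subset),
      ← Set.ncard_eq_toFinset_card', ← Set.ncard_eq_toFinset_card']
    exact Set.ncard_sdiff_singleton_add_one hq hfin

theorem eq_of_subset_of_linearIndepOn (hind : LinearIndepOn ℝ id σ) (hT : T ⊆ σ)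
    (h : σ ⊆ Submodule.span ℝ T) : T = σ := by
  refine hT.antisymm fun x hx => ?_
  by_contra hxT
  refine hind.notMem_span hx ?_
  rw [Set.image_id]
  exact Submodule.span_mono (t := σ \ {x}) (fun t ht => ⟨hT ht, fun e => hxT (e ▸ ht)⟩) (h hx)

/-- The coefficient at `q` is the value of the integral functional of the facet opposite to `q`. -/
theorem IsTwoLevel.mem_span_int_of_linearIndepOn (hind : LinearIndepOn ℝ id T)
    (hTL : ∀ x ∈ T, x ∈ L) (h : IsTwoLevel L T) {b : Space d} (hb : b ∈ L)
    (hbT : b ∈ Submodule.span ℝ T) : b ∈ Submodule.span ℤ T := by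
  have hfin : T.Finite := hind.setFinite
  obtain ⟨τ, rfl⟩ := hfin.exists_finset_coe
  obtain ⟨c, -, rfl⟩ := Submodule.mem_span_finset.1 hbT
  refine sum_mem fun q hq => ?_
  have hqn := hind.notMem_span hq
  rw [Set.image_id] at hqn
  obtain ⟨g, hgq, hg⟩ := Submodule.exists_le_ker_of_notMem hqn
  have hgq' : g q ≠ 0 := hgq
  have hfq : ((g q)⁻¹ • g) q = 1 := by simp [hgq']
  have hf0 : ∀ x ∈ (τ : Set (Space d)), x ≠ q → ((g q)⁻¹ • g) x = 0 := fun x hx hxq => by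
    have : g x = 0 := hg (Submodule.subset_span ⟨hx, hxq⟩)
    simp [this]
  obtain ⟨u, hu, hux⟩ := h _ (isFacetFunctional_of_linearIndepOn hind hq hfq hf0)
  obtain ⟨m, hm⟩ := hu _ hb
  have hcq : c q = m := by
    rw [← hm, map_sum, Finset.sum_eq_single q]
    · rw [map_smul, (hux q (hTL q hq) (subset_convexHull ℝ _ hq)).2 (by rw [hfq]; simp)]
      simp
    · intro x hx hxq
      rw [map_smul, (hux x (hTL x hx) (subset_convexHull ℝ _ hx)).1 (hf0 x hx hxq)]
      simp
    · exact fun hn => absurd hq hn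
  rw [hcq, Int.cast_smul_eq_zsmul]
  exact Submodule.smul_mem _ _ (Submodule.subset_span hq)

theorem IsTwoLevel.mem_span_int (hT : T.Finite) (h : IsTwoLevel L T) (hl : IsPointList w T l)
    (hlL : ∀ x ∈ l, x ∈ L) (hσ : IsPullingSimplex (convexHull ℝ T) l σ) {b : Space d}
    (hb : b ∈ L) (hbσ : b ∈ Submodule.span ℝ σ) : b ∈ Submodule.span ℤ σ := by
  classical
  refine IsPullingSimplex.induction_convexHull
    (motive := fun T l σ => T.Finite → IsTwoLevel L T → (∀ x ∈ l, x ∈ L) →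
      ∀ b ∈ L, b ∈ Submodule.span ℝ σ → b ∈ Submodule.span ℤ σ)
    ?_ ?_ hl hσ hT h hlL b hb hbσ
  · intro T p l hl hind _ h hlL b hb hbσ
    have hTσ : T = {x | x ∈ p :: l} := eq_of_subset_of_linearIndepOn hind hl.mem_list
      fun x hx => convexHull_subset_span (hl.mem_hull x hx)
    rw [← hTσ] at hind hbσ ⊢
    exact h.mem_span_int_of_linearIndepOn hind (fun x hx => hlL x (hl.mem_list x hx)) hb hbσ
  · intro T p l f σ hl hf _ hfp hσ ih hT h hlL b hb hbσ
    obtain ⟨a, z, hz, rfl⟩ := Submodule.mem_span_insert.1 hbσ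
    obtain ⟨u, hu, hux⟩ := h f hf
    obtain ⟨m, hm⟩ := hu _ hb
    have hpl := List.mem_cons_self (a := p) (l := l)
    have huσ : Submodule.span ℝ σ ≤ LinearMap.ker u := by
      rw [Submodule.span_le]
      intro x hx
      have hxl := hσ.subset x hx
      have hxZ := hσ.subset_convexHull hl.filter hx
      exact (hux x (hlL x (List.mem_of_mem_filter hxl))
        (convexHull_mono zeroSet_subset hxZ)).1 (vanish_on_hull (convexHull_subset_hull hxZ))
    have huz : u z = 0 := huσ hz
    -- `u` is `1` at `p` and `0` on `σ`, so it reads off the coefficient at `p`; the remainder `z`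
    -- stays in `L`.
    have ha : a = m := by
      rw [← hm, map_add, map_smul, huz, (hux p (hlL p hpl) (hl.mem_hull p hpl)).2 hfp.ne']
      simp
    rw [ha, Int.cast_smul_eq_zsmul] at hb ⊢
    have hzL : z ∈ L := by
      have := sub_mem hb (L.smul_mem m (hlL p hpl))
      simpa using this
    exact add_mem (Submodule.smul_mem _ _ (Submodule.subset_span (Set.mem_insert _ _)))
      (Submodule.span_mono (Set.subset_insert _ _) (ih (hT.subset zeroSet_subset)
        (h.zeroSet hT hf) (fun x hx => hlL x (List.mem_of_mem_filter hx)) z hzL hz))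

/-- Every face met contains a point of `S`, so with `S` listed first each pulled vertex is in `S`.
This avoids having to know that all lattice points are columns. -/
theorem IsPullingSimplex.subset_of_pairwise (hl : IsPointList w T l) (hTS : T ⊆ S)
    (hord : l.Pairwise fun x y => y ∈ S → x ∈ S)
    (hσ : IsPullingSimplex (convexHull ℝ T) l σ) : σ ⊆ S := by
  classical
  refine IsPullingSimplex.induction_convexHull
    (motive := fun T l σ => T ⊆ S → (l.Pairwise fun x y => y ∈ S → x ∈ S) → σ ⊆ S)
    ?_ ?_ hl hσ hTS hord
  · intro T p l hl hind hTS _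
    have hTσ : T = {x | x ∈ p :: l} := eq_of_subset_of_linearIndepOn hind hl.mem_list
      fun x hx => convexHull_subset_span (hl.mem_hull x hx)
    rwa [← hTσ]
  · rintro T p l f σ hl _ ⟨t, ht⟩ _ _ ih hTS hord
    refine Set.insert_subset ?_ (ih (zeroSet_subset.trans hTS) (hord.filter _))
    rcases List.mem_cons.1 (hl.mem_list t ht.1) with rfl | htl
    · exact hTS ht.1
    · exact (List.pairwise_cons.1 hord).1 t htl (hTS ht.1)

theorem IsCompressed.abs_le_abs (hS : S.Finite) (hw : ∀ t ∈ S, w t = 1)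
    (hfin : ((Submodule.span ℤ S : Set (Space d)) ∩ convexHull ℝ S).Finite)
    (h : IsCompressed (Submodule.span ℤ S) (convexHull ℝ S)) (hf : IsFacetFunctional S f)
    (hne : (zeroSet S f).Nonempty) {p q : Space d}
    (hp : p ∈ (Submodule.span ℤ S : Set (Space d)) ∩ convexHull ℝ S)
    (hq : q ∈ (Submodule.span ℤ S : Set (Space d)) ∩ convexHull ℝ S)
    (hfp : f p ≠ 0) (hfq : f q ≠ 0) : |f p| ≤ |f q| := by
  classical
  by_cases hpq : p = q
  · rw [hpq]
  set l := (hfin.toFinset.erase p).toList with hldef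
  have hnd : (p :: l).Nodup := List.nodup_cons.2 ⟨by simp [l], Finset.nodup_toList _⟩
  have hmem : ∀ x, x ∈ p :: l ↔ x ∈ (Submodule.span ℤ S : Set (Space d)) ∩ convexHull ℝ S := by
    intro x
    rw [List.mem_cons, hldef, Finset.mem_toList, Finset.mem_erase, Set.Finite.mem_toFinset]
    constructor
    · rintro (rfl | hx)
      · exact hp
      · exact hx.2
    · intro hx
      by_cases e : x = p
      · exact Or.inl e
      · exact Or.inr ⟨e, hx⟩
  have hl : IsPointList w S (p :: l) :=
    ⟨hw, fun t ht => (hmem t).2 ⟨Submodule.subset_span ht, subset_convexHull ℝ _ ht⟩,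
      fun x hx => ((hmem x).1 hx).2⟩
  have hspan := hf.span_insert (convexHull_subset_span hp.2) hfp
  -- `q` lies in the span of `p` and the facet, hence of other points of the list.
  have hdep : ¬ AffineIndependent ℝ (fun i => (p :: l).get i) := by
    intro hind
    have hli := (IsPullingSimplex.simplex (convexHull ℝ S) p l hind).linearIndepOn hl
    refine hli.1.notMem_span ((hmem q).2 hq) ?_
    rw [Set.image_id]
    have hqs := convexHull_subset_span hq.2
    rw [← hspan] at hqs
    refine Submodule.span_mono ?_ hqs
    rintro x (rfl | hx)
    · exact ⟨List.mem_cons_self, hpq⟩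
    · exact ⟨hl.mem_list x hx.1, fun e => hfq (e ▸ hx.2)⟩
  -- The zero vector is covered only to obtain some simplex of the facet.
  obtain ⟨τ, hτ, -⟩ := exists_isPullingSimplex_mem_hull (hS.subset zeroSet_subset) hne
    hl.filter (hnd.filter _) (zero_mem (PointedCone.hull ℝ (zeroSet S f)))
  have hpull : IsPullingSimplex (convexHull ℝ S) (p :: l) (insert p τ) :=
    .pull _ p l hdep _ ((isFacet_convexHull_iff hw).2 ⟨f, hf, hne, rfl⟩)
      (fun hc => hfp ((mem_convexHull_zeroSet_iff hw hf.1).1 hc).2) τ hτ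
  obtain ⟨s, hs, hmin⟩ := h (p :: l) hnd hmem _ hpull
  refine abs_le_abs_of_simplexVolume_minimal s (w := w)
    (fun x hx => eq_one_of_mem_convexHull hw hx.2) ?_ hmin hs ?_ hq ?_ hfq
  · rw [hs]
    exact fun x hx => (hmem x).1 (hpull.subset x hx)
  · exact fun x hx => vanish_on_hull
      (convexHull_subset_hull (hτ.subset_convexHull hl.filter hx))
  · rw [hs, (hpull.linearIndepOn hl).2]
    exact convexHull_subset_span hq.2

theorem exists_int_eq_of_mem_span_int {h : Dual ℝ (Space d)}
    (hS : ∀ t ∈ S, ∃ m : ℤ, h t = m) {x : Space d} (hx : x ∈ Submodule.span ℤ S) :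
    ∃ m : ℤ, h x = m := by
  induction hx using Submodule.span_induction with
  | mem x hx => exact hS x hx
  | zero => exact ⟨0, by simp⟩
  | add x y _ _ hx hy =>
    obtain ⟨m, hm⟩ := hx
    obtain ⟨k, hk⟩ := hy
    exact ⟨m + k, by simp [hm, hk]⟩
  | smul a x _ hx =>
    obtain ⟨m, hm⟩ := hx
    exact ⟨a * m, by rw [map_zsmul, hm]; simp⟩

theorem IsCompressed.isTwoLevel (hS : S.Finite) (hw : ∀ t ∈ S, w t = 1)
    (hfin : ((Submodule.span ℤ S : Set (Space d)) ∩ convexHull ℝ S).Finite)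
    (h : IsCompressed (Submodule.span ℤ S) (convexHull ℝ S)) :
    IsTwoLevel (Submodule.span ℤ S) S := by
  intro f hf
  have hSL : ∀ t ∈ S, t ∈ (Submodule.span ℤ S : Set (Space d)) ∩ convexHull ℝ S :=
    fun t ht => ⟨Submodule.subset_span ht, subset_convexHull ℝ _ ht⟩
  by_cases hne : (zeroSet S f).Nonempty
  · obtain ⟨p, hpS, hfp⟩ : ∃ p ∈ S, f p ≠ 0 := by
      by_contra! hall
      have h2 := hf.2
      rw [show zeroSet S f = S from zeroSet_subset.antisymm fun t ht => ⟨ht, hall t ht⟩] at h2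
      omega
    have heq : ∀ x ∈ Submodule.span ℤ S, x ∈ convexHull ℝ S → f x ≠ 0 → f x = f p := by
      intro x hx hxc hfx
      have h1 := h.abs_le_abs hS hw hfin hf hne (hSL p hpS) ⟨hx, hxc⟩ hfp hfx
      have h2 := h.abs_le_abs hS hw hfin hf hne ⟨hx, hxc⟩ (hSL p hpS) hfx hfp
      rw [abs_of_nonneg (hf.1 p hpS),
        abs_of_nonneg (nonneg_of_mem_hull hf.1 (convexHull_subset_hull hxc))] at h1 h2
      linarith
    have hval : ∀ x ∈ Submodule.span ℤ S, x ∈ convexHull ℝ S →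
        (f x = 0 → ((f p)⁻¹ • f) x = 0) ∧ (f x ≠ 0 → ((f p)⁻¹ • f) x = 1) := by
      intro x hx hxc
      refine ⟨fun h0 => by simp [h0], fun h0 => ?_⟩
      simp [heq x hx hxc h0, hfp]
    refine ⟨(f p)⁻¹ • f, fun x hx => exists_int_eq_of_mem_span_int (fun t ht => ?_) hx, hval⟩
    obtain ⟨h0, h1⟩ := hval t (hSL t ht).1 (hSL t ht).2
    by_cases hft : f t = 0
    · exact ⟨0, by simpa using h0 hft⟩
    · exact ⟨1, by simpa using h1 hft⟩
  -- With no zeros in `S`, no point of the hull is a zero of `f`, and `w` is constantly `1` there.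
  · refine ⟨w, fun x hx => exists_int_eq_of_mem_span_int (fun t ht => ⟨1, by simp [hw t ht]⟩) hx,
      fun x _ hxc => ⟨fun h0 => ?_, fun _ => eq_one_of_mem_convexHull hw hxc⟩⟩
    have := (mem_convexHull_zeroSet_iff hw hf.1).2 ⟨hxc, h0⟩
    exact absurd (convexHull_nonempty_iff.1 ⟨x, this⟩) hne

/-- By independence the integral and the nonnegative coefficients coincide. -/
theorem mem_closure_of_mem_span_int_of_mem_hull (hind : LinearIndepOn ℝ id σ) {z : Space d}
    (hz : z ∈ Submodule.span ℤ σ) (hz' : z ∈ PointedCone.hull ℝ σ) :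
    z ∈ AddSubmonoid.closure σ := by
  have hfin : σ.Finite := hind.setFinite
  obtain ⟨τ, rfl⟩ := hfin.exists_finset_coe
  obtain ⟨m, -, rfl⟩ := Submodule.mem_span_finset.1 hz
  obtain ⟨c, -, hc⟩ := Submodule.mem_span_finset.1 hz'
  refine sum_mem fun x hx => ?_
  have hmc : ∀ x ∈ τ, (m x : ℝ) - c x = 0 := by
    refine linearIndepOn_finset_iff.1 hind (fun x => (m x : ℝ) - c x) ?_
    simp only [id, sub_smul, Finset.sum_sub_distrib, Int.cast_smul_eq_zsmul]
    rw [← hc]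
    exact sub_self _
  have h0 : 0 ≤ m x := by
    have h1 := hmc x hx
    have h2 : (0 : ℝ) ≤ c x := (c x).2
    have : (0 : ℝ) ≤ m x := by linarith
    exact_mod_cast this
  obtain ⟨k, hk⟩ := Int.eq_ofNat_of_zero_le h0
  rw [hk, natCast_zsmul]
  exact nsmul_mem (AddSubmonoid.subset_closure hx) k

theorem IsCompressed.roundsUp (hS : S.Finite) (hw : ∀ t ∈ S, w t = 1)
    (hfin : ((Submodule.span ℤ S : Set (Space d)) ∩ convexHull ℝ S).Finite)
    (h : IsCompressed (Submodule.span ℤ S) (convexHull ℝ S)) : RoundsUp S := by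
  classical
  intro b hb p hp a ha c hc hbc
  -- Order: `p`, then the other points of `S`, then the remaining lattice points.
  set l₁ := (hS.toFinset.erase p).toList with hl₁
  set l₂ := (hfin.toFinset \ hS.toFinset).toList with hl₂
  have hSL : ∀ t ∈ S, t ∈ (Submodule.span ℤ S : Set (Space d)) ∩ convexHull ℝ S :=
    fun t ht => ⟨Submodule.subset_span ht, subset_convexHull ℝ _ ht⟩
  have hm₁ : ∀ x, x ∈ l₁ ↔ x ≠ p ∧ x ∈ S := by simp [hl₁]
  have hm₂ : ∀ x, x ∈ l₂ ↔
      x ∈ (Submodule.span ℤ S : Set (Space d)) ∩ convexHull ℝ S ∧ x ∉ S := by simp [hl₂]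
  have hnd : (p :: (l₁ ++ l₂)).Nodup := by
    rw [List.nodup_cons, List.nodup_append']
    refine ⟨?_, Finset.nodup_toList _, Finset.nodup_toList _, ?_⟩
    · rw [List.mem_append, hm₁, hm₂]
      tauto
    · intro x h1 h2
      exact ((hm₂ x).1 h2).2 ((hm₁ x).1 h1).2
  have hmem : ∀ x, x ∈ p :: (l₁ ++ l₂) ↔
      x ∈ (Submodule.span ℤ S : Set (Space d)) ∩ convexHull ℝ S := by
    intro x
    rw [List.mem_cons, List.mem_append, hm₁, hm₂]
    constructor
    · rintro (rfl | hx | hx)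
      · exact hSL _ hp
      · exact hSL _ hx.2
      · exact hx.1
    · tauto
  have hord : (p :: (l₁ ++ l₂)).Pairwise fun x y => y ∈ S → x ∈ S := by
    rw [List.pairwise_cons, List.pairwise_append]
    refine ⟨fun _ _ _ => hp, ?_, ?_, ?_⟩
    · exact List.pairwise_of_forall_mem_list fun x hx y _ _ => ((hm₁ x).1 hx).2
    · exact List.pairwise_of_forall_mem_list fun x _ y hy hyS => absurd hyS ((hm₂ y).1 hy).2
    · exact fun x hx y _ _ => ((hm₁ x).1 hx).2
  have hl : IsPointList w S (p :: (l₁ ++ l₂)) :=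
    ⟨hw, fun t ht => (hmem t).2 (hSL t ht), fun x hx => ((hmem x).1 hx).2⟩
  obtain ⟨σ, hσ, hcσ⟩ := exists_isPullingSimplex_mem_hull hS ⟨p, hp⟩ hl hnd hc
  have hpσ := hσ.head_mem
  have hσS := hσ.subset_of_pairwise hl subset_rfl hord
  have hbσ : b ∈ PointedCone.hull ℝ σ := by
    rw [hbc]; exact add_mem (smul_mem_hull (Submodule.subset_span hpσ) ha) hcσ
  have hind := (hσ.linearIndepOn hl).1
  have hbZ := (h.isTwoLevel hS hw hfin).mem_span_int hS hl (fun x hx => ((hmem x).1 hx).1) hσ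
    (closure_subset_span_int hb) (hull_subset_span hbσ)
  have hins : insert p (σ \ {p}) = σ := by
    rw [Set.insert_sdiff_singleton, Set.insert_eq_of_mem hpσ]
  rw [← hins] at hbZ hcσ
  obtain ⟨m, z, hz, rfl⟩ := Submodule.mem_span_insert.1 hbZ
  obtain ⟨μ, z', hz', rfl⟩ := Submodule.mem_span_insert.1 hcσ
  have hbc' : m • p + z = a • p + ((μ : ℝ) • p + z') := hbc
  have hmem' : ((m : ℝ) - a - μ) • p ∈ Submodule.span ℝ (id '' (σ \ {p})) := by
    have : ((m : ℝ) - a - μ) • p = z' - z := by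
      rw [sub_smul, sub_smul, Int.cast_smul_eq_zsmul, eq_sub_of_add_eq hbc']
      abel
    rw [this, Set.image_id]
    exact sub_mem (hull_subset_span hz') (Submodule.span_le_restrictScalars ℤ ℝ _ hz)
  -- Comparing coefficients at `p` gives `m = a + μ`, so `m` is at least `a`.
  have hm : (m : ℝ) - a - μ = 0 := hind.eq_zero_of_smul_mem_span hpσ _ hmem'
  have hμ : (0 : ℝ) ≤ μ := μ.2
  obtain ⟨k, rfl⟩ := Int.eq_ofNat_of_zero_le
    (show 0 ≤ m by exact_mod_cast (show (0 : ℝ) ≤ m by linarith))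
  have hzz : z = z' := by
    have : (k : ℝ) = a + μ := by push_cast at hm; linarith
    rw [← add_assoc, ← add_smul, ← this, Nat.cast_smul_eq_nsmul ℝ, natCast_zsmul] at hbc'
    exact add_left_cancel hbc'
  refine ⟨k, by push_cast at hm; linarith, z, ?_, by rw [natCast_zsmul]⟩
  exact AddSubmonoid.closure_mono (Set.sdiff_subset.trans hσS)
    (mem_closure_of_mem_span_int_of_mem_hull (hind.mono Set.sdiff_subset) hz (hzz ▸ hz'))

end Backward

/-! ### Translation between the programs and the semigroup -/

section Programs

variable {d n : ℕ} (A : Matrix (Fin d) (Fin n) ℤ)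

theorem mulVec_map_eq_sum (x : Fin n → ℝ) :
    (A.map (fun a : ℤ => (a : ℝ))).mulVec x = ∑ j, x j • colPoint A j := by
  ext k
  simp [Matrix.mulVec, dotProduct, colPoint, mul_comm]

theorem mem_lpFeasible_iff {b : Fin d → ℤ} {x : Fin n → ℝ} :
    x ∈ lpFeasible A b ↔ ∑ j, x j • colPoint A j = (fun k => (b k : ℝ)) ∧ 0 ≤ x := by
  rw [← mulVec_map_eq_sum]; rfl

theorem cast_mem_lpFeasible_iff {b : Fin d → ℤ} {y : Fin n → ℤ} :
    (fun j => (y j : ℝ)) ∈ lpFeasible A b ↔ y ∈ ipFeasible A b := by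
  have h1 : (A.map (fun a : ℤ => (a : ℝ))).mulVec (fun j => (y j : ℝ))
      = fun k => ((A.mulVec y k : ℤ) : ℝ) := by
    ext k; simp [Matrix.mulVec, dotProduct]
  refine and_congr ?_ ?_
  · rw [h1]
    constructor
    · intro h; ext k; exact_mod_cast congrFun h k
    · intro h; rw [h]
  · simp [Pi.le_def]

theorem mem_ipFeasible_iff {b : Fin d → ℤ} {y : Fin n → ℤ} :
    y ∈ ipFeasible A b ↔ ∑ j, (y j : ℝ) • colPoint A j = (fun k => (b k : ℝ)) ∧ 0 ≤ y := by
  rw [← cast_mem_lpFeasible_iff, mem_lpFeasible_iff]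
  simp [Pi.le_def]

theorem lpMax_eq_ipMax_iff {b : Fin d → ℤ} {i : Fin n} :
    lpMax A b i = ipMax A b i ↔
      ∀ x ∈ lpFeasible A b, ∃ y ∈ ipFeasible A b, x i ≤ (y i : ℝ) := by
  constructor
  · intro h x hx
    by_contra! hlt
    -- Integer values below `x i` are at most `⌈x i⌉ - 1`, a bound still below `x i`, so the
    -- supremum cannot reach it.
    have h1 : ipMax A b i ≤ (((⌈x i⌉ - 1 : ℤ) : ℝ) : EReal) := by
      refine iSup₂_le fun y hy => ?_
      rw [EReal.coe_le_coe_iff]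
      exact_mod_cast Int.le_sub_one_of_lt (Int.lt_ceil.2 (hlt y hy))
    have h2 : ((x i : ℝ) : EReal) ≤ lpMax A b i :=
      le_iSup₂ (f := fun (x : Fin n → ℝ) (_ : x ∈ lpFeasible A b) => ((x i : ℝ) : EReal)) x hx
    have h3 := h2.trans (h.le.trans h1)
    rw [EReal.coe_le_coe_iff] at h3
    have := Int.ceil_lt_add_one (x i)
    push_cast at h3
    linarith
  · intro h
    refine le_antisymm (iSup₂_le fun x hx => ?_) (iSup₂_le fun y hy => ?_)
    · obtain ⟨y, hy, hxy⟩ := h x hx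
      exact (EReal.coe_le_coe_iff.2 hxy).trans (le_iSup₂
        (f := fun (y : Fin n → ℤ) (_ : y ∈ ipFeasible A b) => (((y i : ℤ) : ℝ) : EReal)) y hy)
    · exact le_iSup₂ (f := fun (x : Fin n → ℝ) (_ : x ∈ lpFeasible A b) => ((x i : ℝ) : EReal))
        _ ((cast_mem_lpFeasible_iff A).2 hy)

theorem mem_closure_range_colPoint_iff {b : Space d} :
    b ∈ AddSubmonoid.closure (Set.range (colPoint A)) ↔
      ∃ y : Fin n → ℕ, ∑ j, y j • colPoint A j = b := by
  rw [← Submodule.span_nat_eq_addSubmonoidClosure, Submodule.mem_toAddSubmonoid,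
    Submodule.mem_span_range_iff_exists_fun]

theorem roundsUp_range_colPoint_iff :
    RoundsUp (Set.range (colPoint A)) ↔ ∀ (i : Fin n) (b : Fin d → ℤ),
      (ipFeasible A b).Nonempty → lpMax A b i = ipMax A b i := by
  simp_rw [lpMax_eq_ipMax_iff]
  constructor
  · intro h i b ⟨y₀, hy₀⟩ x hx
    obtain ⟨hy₀b, hy₀0⟩ := (mem_ipFeasible_iff A).1 hy₀
    obtain ⟨hxb, hx0⟩ := (mem_lpFeasible_iff A).1 hx
    have hb : (fun k => (b k : ℝ)) ∈ AddSubmonoid.closure (Set.range (colPoint A)) := by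
      rw [← hy₀b]
      refine sum_mem fun j _ => ?_
      obtain ⟨m, hm⟩ := Int.eq_ofNat_of_zero_le (hy₀0 j)
      rw [hm, Int.cast_natCast, Nat.cast_smul_eq_nsmul]
      exact nsmul_mem (AddSubmonoid.subset_closure (Set.mem_range_self j)) m
    obtain ⟨m, hm, c, hc, e⟩ := h _ hb (colPoint A i) ⟨i, rfl⟩ (x i) (hx0 i)
      (∑ j ∈ Finset.univ.erase i, x j • colPoint A j)
      (sum_mem fun j _ => smul_mem_hull (Submodule.subset_span (Set.mem_range_self j)) (hx0 j))
      (by rw [← hxb, Finset.add_sum_erase _ (fun j => x j • colPoint A j) (Finset.mem_univ i)])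
    obtain ⟨z, rfl⟩ := (mem_closure_range_colPoint_iff A).1 hc
    -- The remainder may itself use column `i`; this only increases the coordinate.
    refine ⟨fun j => (z j : ℤ) + if j = i then (m : ℤ) else 0, ?_, ?_⟩
    · refine (mem_ipFeasible_iff A).2 ⟨?_, fun j => ?_⟩
      · rw [e]
        simp only [Int.cast_add, Int.cast_natCast, add_smul, Finset.sum_add_distrib,
          Nat.cast_smul_eq_nsmul]
        rw [add_comm]
        congr 1
        rw [Finset.sum_eq_single i]
        · simp [Nat.cast_smul_eq_nsmul]
        · intro j _ hj; simp [hj]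
        · simp
      · simp only [Pi.zero_apply]
        split_ifs <;> positivity
    · simp only [if_true, Int.cast_add, Int.cast_natCast]
      have : (0 : ℝ) ≤ z i := by positivity
      linarith
  · rintro h b hb _ ⟨i, rfl⟩ a ha c hc hbc
    obtain ⟨y, rfl⟩ := (mem_closure_range_colPoint_iff A).1 hb
    obtain ⟨g, rfl⟩ := (Submodule.mem_span_range_iff_exists_fun _).1 hc
    have hyf : (fun j => (y j : ℤ)) ∈ ipFeasible A (A.mulVec fun j => (y j : ℤ)) :=
      ⟨rfl, fun j => by simp⟩
    have hyb := ((mem_ipFeasible_iff A).1 hyf).1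
    simp only [Int.cast_natCast, Nat.cast_smul_eq_nsmul] at hyb
    obtain ⟨y', hy', hle⟩ := h i _ ⟨_, hyf⟩ (fun j => (g j : ℝ) + if j = i then a else 0) (by
      refine (mem_lpFeasible_iff A).2 ⟨?_, fun j => ?_⟩
      · rw [← hyb, hbc]
        simp only [add_smul, Finset.sum_add_distrib]
        rw [add_comm]
        congr 1
        rw [Finset.sum_eq_single i]
        · simp
        · intro j _ hj; simp [hj]
        · simp
      · have : (0 : ℝ) ≤ g j := (g j).2
        simp only [Pi.zero_apply]
        split_ifs <;> linarith)
    obtain ⟨hyb', hy0⟩ := (mem_ipFeasible_iff A).1 hy'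
    obtain ⟨z, hz⟩ : ∃ z : Fin n → ℕ, ∀ j, y' j = z j :=
      ⟨fun j => (y' j).toNat, fun j => (Int.toNat_of_nonneg (hy0 j)).symm⟩
    simp only [hz, Int.cast_natCast, Nat.cast_smul_eq_nsmul, if_true] at hyb' hle
    refine ⟨z i, ?_, ∑ j ∈ Finset.univ.erase i, z j • colPoint A j,
      sum_mem fun j _ => nsmul_mem (AddSubmonoid.subset_closure (Set.mem_range_self j)) _, ?_⟩
    · have : (0 : ℝ) ≤ g i := (g i).2
      linarith
    · rw [Finset.add_sum_erase _ (fun j => z j • colPoint A j) (Finset.mem_univ i), hyb, hyb']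

theorem finite_colLattice_inter_colPolytope :
    ((colLattice A : Set (Space d)) ∩ colPolytope A).Finite := by
  obtain ⟨R, hR⟩ := ((Set.finite_range (colPoint A)).isCompact_convexHull
    ℝ).isBounded.subset_closedBall 0
  refine (Set.Finite.pi' (fun _ : Fin d =>
    (Set.finite_Icc (-⌈R⌉) ⌈R⌉).image (fun m : ℤ => (m : ℝ)))).subset ?_
  rintro x ⟨hxL, hxP⟩ k
  obtain ⟨m, hm⟩ := exists_int_eq_of_mem_span_int (h := LinearMap.proj k)
    (by rintro _ ⟨j, rfl⟩; exact ⟨A k j, rfl⟩) hxL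
  have hm' : x k = m := hm
  have h1 := (norm_le_pi_norm x k).trans (mem_closedBall_zero_iff.1 (hR hxP))
  rw [Real.norm_eq_abs, abs_le, hm'] at h1
  have h2 := Int.le_ceil R
  refine ⟨m, ⟨?_, ?_⟩, hm'.symm⟩
  · exact_mod_cast (show ((-⌈R⌉ : ℤ) : ℝ) ≤ m by push_cast; linarith)
  · exact_mod_cast (show (m : ℝ) ≤ (⌈R⌉ : ℤ) by linarith)

end Programs

theorem theorem4p2 {d n : ℕ} (A : Matrix (Fin d) (Fin n) ℤ) (hA : IsHomogeneousMatrix A) :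
    (∀ (i : Fin n) (b : Fin d → ℤ), (ipFeasible A b).Nonempty → lpMax A b i = ipMax A b i) ↔
      IsCompressed (colLattice A) (colPolytope A) := by
  obtain ⟨v, -, hv⟩ := hA
  let w : Dual ℝ (Space d) :=
    { toFun := fun x => v ⬝ᵥ x
      map_add' := dotProduct_add v
      map_smul' := fun c x => dotProduct_smul c v x }
  have hw : ∀ t ∈ Set.range (colPoint A), w t = 1 := by
    rintro _ ⟨i, rfl⟩
    exact hv i
  rw [← roundsUp_range_colPoint_iff]
  exact ⟨fun h => h.isCompressed hw, fun h => IsCompressed.roundsUp (Set.finite_range _) hw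
    (finite_colLattice_inter_colPolytope A) h⟩
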